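/- Let $a\in\mathbb R^n$ be a constant vector, $U\subseteq\mathbb R^n$ an open set (in particular, any domain), and for $x\in U$, $y\in\mathbb R^n\setminus\{0\}$ put $$r=|y|,\quad u=|x|^2,\quad s=\frac{\langle x,y\rangle}{|y|},\quad v=\langle a,x\rangle,\quad t=\frac{\langle a,y\rangle}{|y|},\quad a^2=|a|^2 .$$ Let $\phi$ be a $C^\infty$ function on an open subset of $\mathbb R^4$ containing all these values $(u,s,v,t)$, and suppose that $F=r\,\phi(u,s,v,t)$ is a Finsler metric on $U$ (nonnegative, smooth for $y\ne0$, positively 1-homogeneous in $y$, with $g_{ij}=\frac12(F^2)_{y^iy^j}$ positive definite for $y\neq 0$). If $n=2$, suppose moreover that $c_0:=\phi^2-s\phi\phi_s-t\phi\phi_t$ does not vanish at the values $(u,s,v,t)$ (for $n\ge3$ this is automatic). Let $$G^i=\tfrac14 g^{il}\{(F^2)_{x^ky^l}y^k-(F^2)_{x^l}\},\qquad L_{ijk}=-\tfrac12FF_{y^l}\frac{\partial^3G^l}{\partial y^i\partial y^j\partial y^k},\qquad J_i=g^{jk}L_{ijk},$$ $$J_{i|j}=\frac{\partial J_i}{\partial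 x^j}-\frac{\partial J_i}{\partial y^m}\frac{\partial G^m}{\partial y^j}-J_m\frac{\partial^2G^m}{\partial y^i\partial y^j},\qquad \bar\Sigma_{ij}=2(J_{i|j}-J_{j|i}),$$ and call $F$ weakly stretch if $\bar\Sigma_{ij}=0$ for all $x\in U$, $y\ne0$ and all $i,j$. Write $\mathsf p=u-s^2$, $\mathsf q=v-st$, $\mathsf w=a^2-t^2$, $\sigma_1=\phi-s\phi_s-t\phi_t$, $\Delta=\phi_{ss}\phi_{tt}-\phi_{st}^2$, $\rho=\sigma_1^2+\sigma_1(\mathsf p\phi_{ss}+2\mathsf q\phi_{st}+\mathsf w\phi_{tt})+(\mathsf p\mathsf w-\mathsf q^2)\Delta$, $\lambda=2s\phi_{us}+\phi_{ss}+t\phi_{sv}-2\phi_u$, $\mu=2s\phi_{ut}+\phi_{st}+t\phi_{vt}-\phi_v$, and define functions of $(u,s,v,t)$ by $$Q=\frac{(\sigma_1+\mathsf q\phi_{st}+\mathsf w\phi_{tt})\lambda-(\mathsf q\phi_{ss}+\mathsf w\phi_{st})\mu}{2\rho},\qquad R=\frac{(\sigma_1+\mathsf p\phi_{ss}+\mathsf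 q\phi_{st})\mu-(\mathsf p\phi_{st}+\mathsf q\phi_{tt})\lambda}{2\rho},$$ $$P=\frac{2s\phi_u+\phi_s+t\phi_v}{2\phi}-sQ-tR-\frac{\phi_s(\mathsf pQ+\mathsf qR)+\phi_t(\mathsf qQ+\mathsf wR)}{\phi},$$ $$A=\frac{\sigma_1\phi_{ss}+\mathsf w\Delta}{\rho},\quad B=\frac{\sigma_1\phi_{st}-\mathsf q\Delta}{\rho},\quad C=\frac{\sigma_1\phi_{tt}+\mathsf p\Delta}{\rho},\qquad e=s\phi+\mathsf p\phi_s+\mathsf q\phi_t,\quad f=t\phi+\mathsf q\phi_s+\mathsf w\phi_t,$$ \begin{align*} L_1&=3\phi_sP_{ss}+\phi P_{sss}+eQ_{sss}+fR_{sss},\\ L_2&=-\phi(sP_{ss}+tP_{st})+\phi_s(P-sP_s-tP_t)+e(Q_s-sQ_{ss}-tQ_{st})+f(R_s-sR_{ss}-tR_{st}),\\ L_3&=\phi P_{ttt}+3\phi_tP_{tt}+eQ_{ttt}+fR_{ttt},\\ L_4&=-\phi(tP_{tt}+sP_{st})+\phi_t(P-sP_s-tP_t)+e(Q_t-tQ_{tt}-sQ_{st})+f(R_t-tR_{tt}-sR_{st}),\\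 L_5&=\phi_tP_{ss}+2\phi_sP_{st}+\phi P_{sst}+eQ_{sst}+fR_{sst},\\ L_6&=\phi_sP_{tt}+2\phi_tP_{st}+\phi P_{stt}+eQ_{stt}+fR_{stt}, \end{align*} \begin{align*} \varphi_0&=-\mathsf p+A\mathsf p^2+2B\mathsf p\mathsf q+C\mathsf q^2,\quad \varphi_1=-(n+1)+3A\mathsf p+4B\mathsf q+C\mathsf w,\quad \varphi_2=A\mathsf q+B\mathsf w,\\ \varphi_3&=-\mathsf q+A\mathsf p\mathsf q+B(\mathsf q^2+\mathsf p\mathsf w)+C\mathsf q\mathsf w,\quad \varphi_4=-\mathsf w+A\mathsf q^2+2B\mathsf q\mathsf w+C\mathsf w^2,\\ \varphi_5&=B\mathsf p+C\mathsf q,\quad \varphi_6=-(n+1)+A\mathsf p+4B\mathsf q+3C\mathsf w, \end{align*} \begin{align*} K&=\frac{\phi}{2c_0}\{\varphi_0L_1+\varphi_1L_2+2\varphi_2L_4+2\varphi_3L_5+\varphi_4L_6\},\\ H&=\frac{\phi}{2c_0}\{2\varphi_5L_2+\varphi_4L_3+\varphi_6L_4+\varphi_0L_5+2\varphi_3L_6\},\\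 T&=K_v-2H_u+(H_s-K_t)P+(sK+tH)(Q_t-R_s)+(Q_sH_s-Q_tK_s)\mathsf p\\ &\quad+(R_sH_s-R_tK_s+Q_sH_t-Q_tK_t)\mathsf q+(R_sH_t-R_tK_t)\mathsf w,\\ Z&=2sH_u+tH_v+H_s-HP+2(sK+tH)R-(2QH_s+Q_tK)\mathsf p\\ &\quad-(2RH_s+R_tK+2QH_t+Q_tH)\mathsf q-(2RH_t+R_tH)\mathsf w,\\ W&=2sK_u+tK_v+K_s-KP+2(sK+tH)Q-(2QK_s+Q_sK)\mathsf p\\ &\quad-(2RK_s+R_sK+2QK_t+Q_sH)\mathsf q-(2RK_t+R_sH)\mathsf w. \end{align*} Then, for all $x\in U$, $y\ne0$ and all $i$, $G^i=rPy^i+r^2Qx^i+r^2Ra^i$ and $J_i=K\big(x^i-s\frac{y^i}{r}\big)+H\big(a^i-t\frac{y^i}{r}\big)$; and $F$ is weakly stretch if and only if $$rT(x^ia^j-x^ja^i)+(sT+Z)(a^iy^j-a^jy^i)+(W-tT)(x^iy^j-x^jy^i)=0$$ for all $x\in U$, all $y\neq0$ and all $i,j$. -/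

import Mathlib

open scoped ContDiff

noncomputable section

namespace GSS

/-! ### Finsler geometry on an open subset of `ℝⁿ`, in the standard coordinates

A function on the tangent bundle of `U ⊆ ℝⁿ` is written `f x y`, where `x` is the base point
and `y` the tangent vector. -/

/-- Euclidean space `ℝⁿ`. -/
abbrev E (n : ℕ) := EuclideanSpace ℝ (Fin n)

/-- The partial derivative `∂f/∂xⁱ`. -/
def dx {n : ℕ} (i : Fin n) (f : E n → E n → ℝ) (x y : E n) : ℝ :=
  fderiv ℝ (fun z => f z y) x (EuclideanSpace.single i 1)

/-- The partial derivative `∂f/∂yⁱ`. -/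
def dy {n : ℕ} (i : Fin n) (f : E n → E n → ℝ) (x y : E n) : ℝ :=
  fderiv ℝ (fun z => f x z) y (EuclideanSpace.single i 1)

/-- The fundamental tensor `g_{ij} = ½ ∂²(F²)/∂yⁱ∂yʲ`. -/
def fundamental {n : ℕ} (F : E n → E n → ℝ) (x y : E n) : Matrix (Fin n) (Fin n) ℝ :=
  Matrix.of fun i j => (1 / 2) * dy i (dy j fun x y => F x y ^ 2) x y

/-- `F` is a Finsler metric on `U`: nonnegative, smooth off the zero section, positively
1-homogeneous in `y`, and with positive definite fundamental tensor at every `y ≠ 0`. -/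
structure IsFinslerMetricOn {n : ℕ} (U : Set (E n)) (F : E n → E n → ℝ) : Prop where
  nonneg : ∀ x ∈ U, ∀ y, 0 ≤ F x y
  smooth : ContDiffOn ℝ ∞ (fun p : E n × E n => F p.1 p.2) (U ×ˢ {y | y ≠ 0})
  homogeneous : ∀ x ∈ U, ∀ y, ∀ c : ℝ, 0 < c → F x (c • y) = c * F x y
  posDef : ∀ x ∈ U, ∀ y, y ≠ 0 → (fundamental F x y).PosDef

/-- The geodesic spray coefficients
`Gⁱ = ¼ gⁱˡ ((F²)_{xᵏyˡ} yᵏ - (F²)_{xˡ})`. -/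
def spray {n : ℕ} (F : E n → E n → ℝ) (i : Fin n) (x y : E n) : ℝ :=
  (1 / 4) * ∑ l, (fundamental F x y)⁻¹ i l *
    ((∑ k, dy l (dx k fun x y => F x y ^ 2) x y * y k) - dx l (fun x y => F x y ^ 2) x y)

/-- The Landsberg curvature `L_{ijk} = -½ F F_{yˡ} ∂³Gˡ/∂yⁱ∂yʲ∂yᵏ`. -/
def landsberg {n : ℕ} (F : E n → E n → ℝ) (i j k : Fin n) (x y : E n) : ℝ :=
  -(1 / 2) * F x y * ∑ l, dy l F x y * dy i (dy j (dy k (spray F l))) x y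

/-- The mean Landsberg curvature `J_i = gʲᵏ L_{ijk}`. -/
def meanLandsberg {n : ℕ} (F : E n → E n → ℝ) (i : Fin n) (x y : E n) : ℝ :=
  ∑ j, ∑ k, (fundamental F x y)⁻¹ j k * landsberg F i j k x y

/-- The horizontal covariant derivative `w_{i|j}` of a covector field `w_i(x, y)` with respect to
the Berwald connection:
`w_{i|j} = ∂w_i/∂xʲ - (∂w_i/∂yᵐ)(∂Gᵐ/∂yʲ) - w_m ∂²Gᵐ/∂yⁱ∂yʲ`. -/
def horizontalDeriv {n : ℕ} (F : E n → E n → ℝ) (w : Fin n → E n → E n → ℝ) (i j : Fin n)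
    (x y : E n) : ℝ :=
  dx j (w i) x y - (∑ m, dy m (w i) x y * dy j (spray F m) x y)
    - ∑ m, w m x y * dy i (dy j (spray F m)) x y

/-- The mean stretch curvature `Σ̄_{ij} = 2 (J_{i|j} - J_{j|i})`. -/
def meanStretch {n : ℕ} (F : E n → E n → ℝ) (i j : Fin n) (x y : E n) : ℝ :=
  2 * (horizontalDeriv F (meanLandsberg F) i j x y - horizontalDeriv F (meanLandsberg F) j i x y)

/-- `F` is weakly stretch on `U`: its mean stretch curvature vanishes on the slit tangent bundle. -/
def IsWeaklyStretchOn {n : ℕ} (U : Set (E n)) (F : E n → E n → ℝ) : Prop :=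
  ∀ x ∈ U, ∀ y, y ≠ 0 → ∀ i j, meanStretch F i j x y = 0

/-! ### General spherically symmetric metrics -/

/-- The invariants `(u, s, v, t) = (|x|², ⟨x,y⟩/|y|, ⟨a,x⟩, ⟨a,y⟩/|y|)`. -/
def invariants {n : ℕ} (a x y : E n) : Fin 4 → ℝ :=
  ![‖x‖ ^ 2, inner ℝ x y / ‖y‖, inner ℝ a x, inner ℝ a y / ‖y‖]

/-- The function `F = r φ(u, s, v, t)` with `r = |y|`. -/
def metric {n : ℕ} (φ : (Fin 4 → ℝ) → ℝ) (a x y : E n) : ℝ :=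
  ‖y‖ * φ (invariants a x y)

/-! ### Functions of the four variables `(u, s, v, t)`

A point is `p : Fin 4 → ℝ` with `u = p 0`, `s = p 1`, `v = p 2`, `t = p 3`. -/

/-- The partial derivative `f_u`. -/
def du (f : (Fin 4 → ℝ) → ℝ) (p : Fin 4 → ℝ) : ℝ := fderiv ℝ f p (Pi.single 0 1)

/-- The partial derivative `f_s`. -/
def ds (f : (Fin 4 → ℝ) → ℝ) (p : Fin 4 → ℝ) : ℝ := fderiv ℝ f p (Pi.single 1 1)

/-- The partial derivative `f_v`. -/
def dv (f : (Fin 4 → ℝ) → ℝ) (p : Fin 4 → ℝ) : ℝ := fderiv ℝ f p (Pi.single 2 1)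

/-- The partial derivative `f_t`. -/
def dt (f : (Fin 4 → ℝ) → ℝ) (p : Fin 4 → ℝ) : ℝ := fderiv ℝ f p (Pi.single 3 1)

/-- `u - s²`. -/
def us (p : Fin 4 → ℝ) : ℝ := p 0 - p 1 ^ 2

/-- `v - st`. -/
def vst (p : Fin 4 → ℝ) : ℝ := p 2 - p 1 * p 3

/-- `a² - t²`, where `a2` stands for `a² = |a|²`. -/
def at2 (a2 : ℝ) (p : Fin 4 → ℝ) : ℝ := a2 - p 3 ^ 2

/-- `σ₁ = φ - s φ_s - t φ_t`. -/
def sigma1 (φ : (Fin 4 → ℝ) → ℝ) (p : Fin 4 → ℝ) : ℝ := φ p - p 1 * ds φ p - p 3 * dt φ p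

/-- `c₀ = φ² - s φ φ_s - t φ φ_t`. -/
def c0 (φ : (Fin 4 → ℝ) → ℝ) (p : Fin 4 → ℝ) : ℝ :=
  φ p ^ 2 - p 1 * φ p * ds φ p - p 3 * φ p * dt φ p

/-- `φ_ss φ_tt - φ_st²`. -/
def hess (φ : (Fin 4 → ℝ) → ℝ) (p : Fin 4 → ℝ) : ℝ :=
  ds (ds φ) p * dt (dt φ) p - dt (ds φ) p ^ 2

/-- `ρ = σ₁² + σ₁ ((u-s²) φ_ss + 2 (v-st) φ_st + (a²-t²) φ_tt)
  + ((u-s²)(a²-t²) - (v-st)²)(φ_ss φ_tt - φ_st²)`. -/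
def rho (φ : (Fin 4 → ℝ) → ℝ) (a2 : ℝ) (p : Fin 4 → ℝ) : ℝ :=
  sigma1 φ p ^ 2
    + sigma1 φ p * (us p * ds (ds φ) p + 2 * vst p * dt (ds φ) p + at2 a2 p * dt (dt φ) p)
    + (us p * at2 a2 p - vst p ^ 2) * hess φ p

/-- `λ = 2s φ_us + φ_ss + t φ_sv - 2 φ_u`, the `x`-coefficient in `F_{xᵏyˡ} yᵏ - F_{xˡ}`. -/
def lam (φ : (Fin 4 → ℝ) → ℝ) (p : Fin 4 → ℝ) : ℝ :=
  2 * p 1 * ds (du φ) p + ds (ds φ) p + p 3 * dv (ds φ) p - 2 * du φ p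

/-- `μ = 2s φ_ut + φ_st + t φ_vt - φ_v`, the `a`-coefficient in `F_{xᵏyˡ} yᵏ - F_{xˡ}`. -/
def mu (φ : (Fin 4 → ℝ) → ℝ) (p : Fin 4 → ℝ) : ℝ :=
  2 * p 1 * dt (du φ) p + dt (ds φ) p + p 3 * dt (dv φ) p - dv φ p

/-- The spray coefficient `Q`, in `Gⁱ = r P yⁱ + r² Q xⁱ + r² R aⁱ`. -/
def Q (φ : (Fin 4 → ℝ) → ℝ) (a2 : ℝ) (p : Fin 4 → ℝ) : ℝ :=
  ((sigma1 φ p + vst p * dt (ds φ) p + at2 a2 p * dt (dt φ) p) * lam φ p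
    - (vst p * ds (ds φ) p + at2 a2 p * dt (ds φ) p) * mu φ p) / (2 * rho φ a2 p)

/-- The spray coefficient `R`, in `Gⁱ = r P yⁱ + r² Q xⁱ + r² R aⁱ`. -/
def R (φ : (Fin 4 → ℝ) → ℝ) (a2 : ℝ) (p : Fin 4 → ℝ) : ℝ :=
  ((sigma1 φ p + us p * ds (ds φ) p + vst p * dt (ds φ) p) * mu φ p
    - (us p * dt (ds φ) p + vst p * dt (dt φ) p) * lam φ p) / (2 * rho φ a2 p)

/-- The spray coefficient `P`, in `Gⁱ = r P yⁱ + r² Q xⁱ + r² R aⁱ`. -/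
def P (φ : (Fin 4 → ℝ) → ℝ) (a2 : ℝ) (p : Fin 4 → ℝ) : ℝ :=
  (2 * p 1 * du φ p + ds φ p + p 3 * dv φ p) / (2 * φ p)
    - p 1 * Q φ a2 p - p 3 * R φ a2 p
    - (ds φ p * (us p * Q φ a2 p + vst p * R φ a2 p)
      + dt φ p * (vst p * Q φ a2 p + at2 a2 p * R φ a2 p)) / φ p

/-- `s φ + (u-s²) φ_s + (v-st) φ_t`. -/
def ex (φ : (Fin 4 → ℝ) → ℝ) (p : Fin 4 → ℝ) : ℝ :=
  p 1 * φ p + us p * ds φ p + vst p * dt φ p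

/-- `t φ + (v-st) φ_s + (a²-t²) φ_t`. -/
def ea (φ : (Fin 4 → ℝ) → ℝ) (a2 : ℝ) (p : Fin 4 → ℝ) : ℝ :=
  p 3 * φ p + vst p * ds φ p + at2 a2 p * dt φ p

/-- The Landsberg coefficient `L₁`. -/
def L1 (φ : (Fin 4 → ℝ) → ℝ) (a2 : ℝ) (p : Fin 4 → ℝ) : ℝ :=
  3 * ds φ p * ds (ds (P φ a2)) p + φ p * ds (ds (ds (P φ a2))) p
    + ex φ p * ds (ds (ds (Q φ a2))) p + ea φ a2 p * ds (ds (ds (R φ a2))) p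

/-- The Landsberg coefficient `L₂`. -/
def L2 (φ : (Fin 4 → ℝ) → ℝ) (a2 : ℝ) (p : Fin 4 → ℝ) : ℝ :=
  -φ p * (p 1 * ds (ds (P φ a2)) p + p 3 * dt (ds (P φ a2)) p)
    + ds φ p * (P φ a2 p - p 1 * ds (P φ a2) p - p 3 * dt (P φ a2) p)
    + ex φ p * (ds (Q φ a2) p - p 1 * ds (ds (Q φ a2)) p - p 3 * dt (ds (Q φ a2)) p)
    + ea φ a2 p * (ds (R φ a2) p - p 1 * ds (ds (R φ a2)) p - p 3 * dt (ds (R φ a2)) p)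

/-- The Landsberg coefficient `L₃`. -/
def L3 (φ : (Fin 4 → ℝ) → ℝ) (a2 : ℝ) (p : Fin 4 → ℝ) : ℝ :=
  φ p * dt (dt (dt (P φ a2))) p + 3 * dt φ p * dt (dt (P φ a2)) p
    + ex φ p * dt (dt (dt (Q φ a2))) p + ea φ a2 p * dt (dt (dt (R φ a2))) p

/-- The Landsberg coefficient `L₄`. -/
def L4 (φ : (Fin 4 → ℝ) → ℝ) (a2 : ℝ) (p : Fin 4 → ℝ) : ℝ :=
  -φ p * (p 3 * dt (dt (P φ a2)) p + p 1 * dt (ds (P φ a2)) p)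
    + dt φ p * (P φ a2 p - p 1 * ds (P φ a2) p - p 3 * dt (P φ a2) p)
    + ex φ p * (dt (Q φ a2) p - p 3 * dt (dt (Q φ a2)) p - p 1 * dt (ds (Q φ a2)) p)
    + ea φ a2 p * (dt (R φ a2) p - p 3 * dt (dt (R φ a2)) p - p 1 * dt (ds (R φ a2)) p)

/-- The Landsberg coefficient `L₅`. -/
def L5 (φ : (Fin 4 → ℝ) → ℝ) (a2 : ℝ) (p : Fin 4 → ℝ) : ℝ :=
  dt φ p * ds (ds (P φ a2)) p + 2 * ds φ p * dt (ds (P φ a2)) p + φ p * dt (ds (ds (P φ a2))) p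
    + ex φ p * dt (ds (ds (Q φ a2))) p + ea φ a2 p * dt (ds (ds (R φ a2))) p

/-- The Landsberg coefficient `L₆`. -/
def L6 (φ : (Fin 4 → ℝ) → ℝ) (a2 : ℝ) (p : Fin 4 → ℝ) : ℝ :=
  ds φ p * dt (dt (P φ a2)) p + 2 * dt φ p * dt (ds (P φ a2)) p + φ p * dt (dt (ds (P φ a2))) p
    + ex φ p * dt (dt (ds (Q φ a2))) p + ea φ a2 p * dt (dt (ds (R φ a2))) p

/-- The coefficient `A` of `-xⁱxʲ/c₀` in the inverse fundamental tensor `gⁱʲ`. -/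
def A (φ : (Fin 4 → ℝ) → ℝ) (a2 : ℝ) (p : Fin 4 → ℝ) : ℝ :=
  (sigma1 φ p * ds (ds φ) p + at2 a2 p * hess φ p) / rho φ a2 p

/-- The coefficient `B` of `-(xⁱaʲ + aⁱxʲ)/c₀` in the inverse fundamental tensor `gⁱʲ`. -/
def B (φ : (Fin 4 → ℝ) → ℝ) (a2 : ℝ) (p : Fin 4 → ℝ) : ℝ :=
  (sigma1 φ p * dt (ds φ) p - vst p * hess φ p) / rho φ a2 p

/-- The coefficient `C` of `-aⁱaʲ/c₀` in the inverse fundamental tensor `gⁱʲ`. -/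
def C (φ : (Fin 4 → ℝ) → ℝ) (a2 : ℝ) (p : Fin 4 → ℝ) : ℝ :=
  (sigma1 φ p * dt (dt φ) p + us p * hess φ p) / rho φ a2 p

/-- `φ₀ = -(u-s²) + A (u-s²)² + 2B (u-s²)(v-st) + C (v-st)²`. -/
def phi0 (φ : (Fin 4 → ℝ) → ℝ) (a2 : ℝ) (p : Fin 4 → ℝ) : ℝ :=
  -us p + A φ a2 p * us p ^ 2 + 2 * B φ a2 p * us p * vst p + C φ a2 p * vst p ^ 2

/-- `φ₁ = -(n+1) + 3A (u-s²) + 4B (v-st) + C (a²-t²)`. -/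
def phi1 (n : ℕ) (φ : (Fin 4 → ℝ) → ℝ) (a2 : ℝ) (p : Fin 4 → ℝ) : ℝ :=
  -((n : ℝ) + 1) + 3 * A φ a2 p * us p + 4 * B φ a2 p * vst p + C φ a2 p * at2 a2 p

/-- `φ₂ = A (v-st) + B (a²-t²)`. -/
def phi2 (φ : (Fin 4 → ℝ) → ℝ) (a2 : ℝ) (p : Fin 4 → ℝ) : ℝ :=
  A φ a2 p * vst p + B φ a2 p * at2 a2 p

/-- `φ₃ = -(v-st) + A (u-s²)(v-st) + B ((v-st)² + (u-s²)(a²-t²)) + C (v-st)(a²-t²)`. -/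
def phi3 (φ : (Fin 4 → ℝ) → ℝ) (a2 : ℝ) (p : Fin 4 → ℝ) : ℝ :=
  -vst p + A φ a2 p * us p * vst p + B φ a2 p * (vst p ^ 2 + us p * at2 a2 p)
    + C φ a2 p * vst p * at2 a2 p

/-- `φ₄ = -(a²-t²) + A (v-st)² + 2B (v-st)(a²-t²) + C (a²-t²)²`. -/
def phi4 (φ : (Fin 4 → ℝ) → ℝ) (a2 : ℝ) (p : Fin 4 → ℝ) : ℝ :=
  -at2 a2 p + A φ a2 p * vst p ^ 2 + 2 * B φ a2 p * vst p * at2 a2 p + C φ a2 p * at2 a2 p ^ 2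

/-- `φ₅ = B (u-s²) + C (v-st)`. -/
def phi5 (φ : (Fin 4 → ℝ) → ℝ) (a2 : ℝ) (p : Fin 4 → ℝ) : ℝ :=
  B φ a2 p * us p + C φ a2 p * vst p

/-- `φ₆ = -(n+1) + A (u-s²) + 4B (v-st) + 3C (a²-t²)`. -/
def phi6 (n : ℕ) (φ : (Fin 4 → ℝ) → ℝ) (a2 : ℝ) (p : Fin 4 → ℝ) : ℝ :=
  -((n : ℝ) + 1) + A φ a2 p * us p + 4 * B φ a2 p * vst p + 3 * C φ a2 p * at2 a2 p

/-- The mean Landsberg component `K`, the coefficient of `xⁱ - s yⁱ/r` in `J_i`. -/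
def K (n : ℕ) (φ : (Fin 4 → ℝ) → ℝ) (a2 : ℝ) (p : Fin 4 → ℝ) : ℝ :=
  φ p / (2 * c0 φ p) *
    (phi0 φ a2 p * L1 φ a2 p + phi1 n φ a2 p * L2 φ a2 p + 2 * phi2 φ a2 p * L4 φ a2 p
      + 2 * phi3 φ a2 p * L5 φ a2 p + phi4 φ a2 p * L6 φ a2 p)

/-- The mean Landsberg component `H`, the coefficient of `aⁱ - t yⁱ/r` in `J_i`. -/
def H (n : ℕ) (φ : (Fin 4 → ℝ) → ℝ) (a2 : ℝ) (p : Fin 4 → ℝ) : ℝ :=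
  φ p / (2 * c0 φ p) *
    (2 * phi5 φ a2 p * L2 φ a2 p + phi4 φ a2 p * L3 φ a2 p + phi6 n φ a2 p * L4 φ a2 p
      + phi0 φ a2 p * L5 φ a2 p + 2 * phi3 φ a2 p * L6 φ a2 p)

/-- The expression `T`. -/
def T (n : ℕ) (φ : (Fin 4 → ℝ) → ℝ) (a2 : ℝ) (p : Fin 4 → ℝ) : ℝ :=
  dv (K n φ a2) p - 2 * du (H n φ a2) p
    + (ds (H n φ a2) p - dt (K n φ a2) p) * P φ a2 p
    + (p 1 * K n φ a2 p + p 3 * H n φ a2 p) * (dt (Q φ a2) p - ds (R φ a2) p)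
    + (ds (Q φ a2) p * ds (H n φ a2) p - dt (Q φ a2) p * ds (K n φ a2) p) * us p
    + (ds (R φ a2) p * ds (H n φ a2) p - dt (R φ a2) p * ds (K n φ a2) p
      + ds (Q φ a2) p * dt (H n φ a2) p - dt (Q φ a2) p * dt (K n φ a2) p) * vst p
    + (ds (R φ a2) p * dt (H n φ a2) p - dt (R φ a2) p * dt (K n φ a2) p) * at2 a2 p

/-- The expression `Z`. -/
def Z (n : ℕ) (φ : (Fin 4 → ℝ) → ℝ) (a2 : ℝ) (p : Fin 4 → ℝ) : ℝ :=
  2 * p 1 * du (H n φ a2) p + p 3 * dv (H n φ a2) p + ds (H n φ a2) p - H n φ a2 p * P φ a2 p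
    + 2 * (p 1 * K n φ a2 p + p 3 * H n φ a2 p) * R φ a2 p
    - (2 * Q φ a2 p * ds (H n φ a2) p + dt (Q φ a2) p * K n φ a2 p) * us p
    - (2 * R φ a2 p * ds (H n φ a2) p + dt (R φ a2) p * K n φ a2 p
      + 2 * Q φ a2 p * dt (H n φ a2) p + dt (Q φ a2) p * H n φ a2 p) * vst p
    - (2 * R φ a2 p * dt (H n φ a2) p + dt (R φ a2) p * H n φ a2 p) * at2 a2 p

/-- The expression `W`. -/
def W (n : ℕ) (φ : (Fin 4 → ℝ) → ℝ) (a2 : ℝ) (p : Fin 4 → ℝ) : ℝ :=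
  2 * p 1 * du (K n φ a2) p + p 3 * dv (K n φ a2) p + ds (K n φ a2) p - K n φ a2 p * P φ a2 p
    + 2 * (p 1 * K n φ a2 p + p 3 * H n φ a2 p) * Q φ a2 p
    - (2 * Q φ a2 p * ds (K n φ a2) p + ds (Q φ a2) p * K n φ a2 p) * us p
    - (2 * R φ a2 p * ds (K n φ a2) p + ds (R φ a2) p * K n φ a2 p
      + 2 * Q φ a2 p * dt (K n φ a2) p + ds (Q φ a2) p * H n φ a2 p) * vst p
    - (2 * R φ a2 p * dt (K n φ a2) p + ds (R φ a2) p * H n φ a2 p) * at2 a2 p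

end GSS

end

/-! Put ℓ = y/r, ξ = x - sℓ, η = a - tℓ and m = δ - ℓ⊗ℓ (`ell`, `perp x y`, `perp a y`, `ang`). In
the direction yⁱ the invariants u and v are constant, while s and t have derivatives ξ_i/r and
η_i/r; the derivatives of ℓ, ξ, η and m are again built from ℓ, ξ, η, m and s, t. So every tensor in
the theorem is a polynomial in ℓ, ξ, η, m (and δ) with coefficients depending on r and (u,s,v,t).
Both ξ and η are orthogonal to ℓ, and their Gram matrix has entries u - s², v - st, a² - t², so
contractions also stay within this class.

The fundamental tensor is FF_{yy} + F_y⊗F_y. By `sum_fundamental_mul` it sends αξ + βη + κℓ to a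
combination of ξ, η and F_y; apart from the factor φ, the first two coefficients are N(α,β) with N =
σ₁I + (Hessian of φ in s,t)·(Gram matrix), and det N = ρ. The inverse tensor is never computed: g⁻¹b
is found by exhibiting z with gz = b. For the spray, Cramer's rule for N gives Q and R, and the
F_y-component gives P (`spray_eq`). Three more vertical derivatives contracted with F_y give the
Landsberg tensor (`landsberg_eq`), and its g-trace is J = Kξ + Hη (`meanLandsberg_eq`).

In J_{i|j} - J_{j|i} the term J_m G^m_{ij} is symmetric and cancels. With b∧c = b_i c_j - b_j c_i,
the rest equals T ξ∧η + Z η∧ℓ + W ξ∧ℓ, and substituting ξ = x - sℓ, η = a - tℓ turns this into 1/r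
times the expression of the theorem (`meanStretch_eq`). The equivalence therefore holds pointwise.

The divisors must not vanish. Positive definiteness gives φ ≠ 0 directly, c₀ ≠ 0 for n ≥ 3 by a
monotonicity argument along a line orthogonal to x and a, and then ρ ≠ 0. For n = 1 the numbers c₀
and ρ may vanish, but ξ = η = 0 and a 2-homogeneous spray has zero third derivative, so that case is
settled separately. -/

open scoped ContDiff

noncomputable section

namespace GSS

variable {n : ℕ}

/-! ### Directional derivatives -/

/-- `f` is differentiable at `y` and its derivative in the direction `v` is `d`. -/
def HasDirDeriv {V : Type*} [NormedAddCommGroup V] [NormedSpace ℝ V] (v : V) (f : V → ℝ) (y : V)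
    (d : ℝ) : Prop :=
  ∃ L : V →L[ℝ] ℝ, HasFDerivAt f L y ∧ L v = d

namespace HasDirDeriv

variable {V : Type*} [NormedAddCommGroup V] [NormedSpace ℝ V] {v y : V} {f g : V → ℝ} {d e : ℝ}

theorem fderiv_eq (h : HasDirDeriv v f y d) : fderiv ℝ f y v = d := by
  obtain ⟨L, hL, rfl⟩ := h
  rw [hL.fderiv]

theorem congr_of_eventuallyEq (h : HasDirDeriv v f y d) (hg : g =ᶠ[nhds y] f) :
    HasDirDeriv v g y d := by
  obtain ⟨L, hL, rfl⟩ := h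
  exact ⟨L, hL.congr_of_eventuallyEq hg, rfl⟩

/-- The hinge of every derivative computation below: the rules produce some expression, and its
agreement with a chosen closed form becomes an algebraic identity. -/
theorem congr_deriv (h : HasDirDeriv v f y d) (he : d = e) : HasDirDeriv v f y e := he ▸ h

theorem const (c : ℝ) : HasDirDeriv v (fun _ => c) y 0 :=
  ⟨0, hasFDerivAt_const c y, rfl⟩

theorem add (hf : HasDirDeriv v f y d) (hg : HasDirDeriv v g y e) :
    HasDirDeriv v (fun z => f z + g z) y (d + e) := by
  obtain ⟨L, hL, rfl⟩ := hf
  obtain ⟨M, hM, rfl⟩ := hg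
  exact ⟨L + M, hL.add hM, rfl⟩

theorem sub (hf : HasDirDeriv v f y d) (hg : HasDirDeriv v g y e) :
    HasDirDeriv v (fun z => f z - g z) y (d - e) := by
  obtain ⟨L, hL, rfl⟩ := hf
  obtain ⟨M, hM, rfl⟩ := hg
  exact ⟨L - M, hL.sub hM, rfl⟩

theorem mul (hf : HasDirDeriv v f y d) (hg : HasDirDeriv v g y e) :
    HasDirDeriv v (fun z => f z * g z) y (d * g y + f y * e) := by
  obtain ⟨L, hL, rfl⟩ := hf
  obtain ⟨M, hM, rfl⟩ := hg
  refine ⟨_, hL.mul hM, ?_⟩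
  simp
  ring

/-- The derivative is written with inverses instead of a quotient, so that it is polynomial in (f
y)⁻¹ and accessible to `ring`. -/
theorem inv (hf : HasDirDeriv v f y d) (h0 : f y ≠ 0) :
    HasDirDeriv v (fun z => (f z)⁻¹) y (-d * (f y)⁻¹ * (f y)⁻¹) := by
  obtain ⟨L, hL, rfl⟩ := hf
  refine ⟨_, (hasDerivAt_inv h0).comp_hasFDerivAt y hL, ?_⟩
  simp
  field_simp

theorem comp_fin_four {F : (Fin 4 → ℝ) → ℝ} {G : V → Fin 4 → ℝ} {d₀ d₁ d₂ d₃ : ℝ}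
    (hF : DifferentiableAt ℝ F (G y)) (h₀ : HasDirDeriv v (fun z => G z 0) y d₀)
    (h₁ : HasDirDeriv v (fun z => G z 1) y d₁) (h₂ : HasDirDeriv v (fun z => G z 2) y d₂)
    (h₃ : HasDirDeriv v (fun z => G z 3) y d₃) :
    HasDirDeriv v (fun z => F (G z)) y
      (du F (G y) * d₀ + ds F (G y) * d₁ + dv F (G y) * d₂ + dt F (G y) * d₃) := by
  obtain ⟨L₀, hL₀, rfl⟩ := h₀
  obtain ⟨L₁, hL₁, rfl⟩ := h₁
  obtain ⟨L₂, hL₂, rfl⟩ := h₂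
  obtain ⟨L₃, hL₃, rfl⟩ := h₃
  have hG : HasFDerivAt G (ContinuousLinearMap.pi ![L₀, L₁, L₂, L₃]) y := by
    rw [hasFDerivAt_pi']
    intro k
    fin_cases k
    · exact hL₀
    · exact hL₁
    · exact hL₂
    · exact hL₃
  refine ⟨_, hF.hasFDerivAt.comp y hG, ?_⟩
  have hw : ∀ w : Fin 4 → ℝ, fderiv ℝ F (G y) w =
      du F (G y) * w 0 + ds F (G y) * w 1 + dv F (G y) * w 2 + dt F (G y) * w 3 := by
    intro w
    have h := (fderiv ℝ F (G y)).toLinearMap.pi_apply_eq_sum_univ w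
    simp only [ContinuousLinearMap.coe_coe, Fin.sum_univ_four, smul_eq_mul] at h
    have hs : ∀ i : Fin 4, (fun j => if i = j then (1 : ℝ) else 0) = Pi.single i 1 := by
      intro i
      ext j
      simp [Pi.single_apply, eq_comm]
    simp only [hs] at h
    rw [h]
    simp only [du, ds, dv, dt]
    ring
  rw [ContinuousLinearMap.comp_apply, hw]
  simp

end HasDirDeriv

/-! ### The basic functions on the slit tangent bundle -/

/-- The Kronecker delta. -/
def delta (i j : Fin n) : ℝ := if i = j then 1 else 0

/-- The unit vector `y / |y|`. -/
def ell (y : E n) (i : Fin n) : ℝ := y i / ‖y‖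

/-- The component `z - ⟨z, y⟩ y / |y|²` of `z` orthogonal to `y`. -/
def perp (z y : E n) (i : Fin n) : ℝ := z i - inner ℝ z y / ‖y‖ * ell y i

theorem hasDirDeriv_coord (i k : Fin n) (y : E n) :
    HasDirDeriv (EuclideanSpace.single i 1) (fun z : E n => z k) y (delta i k) := by
  refine ⟨EuclideanSpace.proj k, (EuclideanSpace.proj k : E n →L[ℝ] ℝ).hasFDerivAt, ?_⟩
  simp [delta, eq_comm]

theorem hasDirDeriv_norm (i : Fin n) {y : E n} (hy : y ≠ 0) :
    HasDirDeriv (EuclideanSpace.single i 1) (fun z : E n => ‖z‖) y (ell y i) := by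
  have h0 : ‖y‖ ≠ 0 := norm_ne_zero_iff.2 hy
  have h := (hasStrictFDerivAt_norm_sq y).hasFDerivAt.sqrt (pow_ne_zero 2 h0)
  simp only [Real.sqrt_sq (norm_nonneg _)] at h
  refine ⟨_, h, ?_⟩
  simp [ell, EuclideanSpace.inner_single_right]
  field_simp

theorem hasDirDeriv_inner_right (i : Fin n) (x y : E n) :
    HasDirDeriv (EuclideanSpace.single i 1) (fun z : E n => inner ℝ x z) y (x i) := by
  refine ⟨innerSL ℝ x, (innerSL ℝ x).hasFDerivAt, ?_⟩
  simp [EuclideanSpace.inner_single_right]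

theorem hasDirDeriv_inner_left (i : Fin n) (x y : E n) :
    HasDirDeriv (EuclideanSpace.single i 1) (fun z : E n => inner ℝ z y) x (y i) := by
  simpa only [real_inner_comm] using hasDirDeriv_inner_right i y x

theorem hasDirDeriv_norm_sq (i : Fin n) (x : E n) :
    HasDirDeriv (EuclideanSpace.single i 1) (fun z : E n => ‖z‖ ^ 2) x (2 * x i) := by
  refine ⟨_, (hasStrictFDerivAt_norm_sq x).hasFDerivAt, ?_⟩
  simp [EuclideanSpace.inner_single_right]

theorem hasDirDeriv_inner_div_norm (i : Fin n) (x : E n) {y : E n} (hy : y ≠ 0) :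
    HasDirDeriv (EuclideanSpace.single i 1) (fun z : E n => inner ℝ x z / ‖z‖) y
      (perp x y i * ‖y‖⁻¹) := by
  have h0 : ‖y‖ ≠ 0 := norm_ne_zero_iff.2 hy
  have h := (hasDirDeriv_inner_right i x y).mul ((hasDirDeriv_norm i hy).inv h0)
  simp only [div_eq_mul_inv]
  refine h.congr_deriv ?_
  simp only [perp]
  ring

theorem hasDirDeriv_ell (i k : Fin n) {y : E n} (hy : y ≠ 0) :
    HasDirDeriv (EuclideanSpace.single i 1) (fun z : E n => ell z k) y
      ((delta i k - ell y i * ell y k) * ‖y‖⁻¹) := by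
  have h0 : ‖y‖ ≠ 0 := norm_ne_zero_iff.2 hy
  have h := (hasDirDeriv_coord i k y).mul ((hasDirDeriv_norm i hy).inv h0)
  simp only [ell, div_eq_mul_inv] at h ⊢
  refine h.congr_deriv ?_
  ring

/-- With `hasDirDeriv_ell` and `hasDirDeriv_ang`, this shows that ℓ, ξ, η, m are closed under
vertical differentiation, so that jets of any order stay polynomial in them. -/
theorem hasDirDeriv_perp (i k : Fin n) (x : E n) {y : E n} (hy : y ≠ 0) :
    HasDirDeriv (EuclideanSpace.single i 1) (fun z : E n => perp x z k) y
      (-(perp x y i * ell y k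
        + inner ℝ x y / ‖y‖ * (delta i k - ell y i * ell y k)) * ‖y‖⁻¹) := by
  have h := (HasDirDeriv.const (v := EuclideanSpace.single i (1 : ℝ)) (y := y) (x k)).sub
    ((hasDirDeriv_inner_div_norm i x hy).mul (hasDirDeriv_ell i k hy))
  refine h.congr_deriv ?_
  ring

theorem hasDirDeriv_perp_left (i k : Fin n) (x y : E n) :
    HasDirDeriv (EuclideanSpace.single i 1) (fun z : E n => perp z y k) x
      (delta i k - ell y i * ell y k) := by
  have h := (hasDirDeriv_coord i k x).sub
    (((hasDirDeriv_inner_left i x y).mul (.const ‖y‖⁻¹)).mul (.const (ell y k)))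
  simp only [perp, div_eq_mul_inv]
  refine h.congr_deriv ?_
  simp only [ell]
  ring

theorem hasDirDeriv_comp_invariants (i : Fin n) (a x : E n) {y : E n} (hy : y ≠ 0)
    {f : (Fin 4 → ℝ) → ℝ} (hf : DifferentiableAt ℝ f (invariants a x y)) :
    HasDirDeriv (EuclideanSpace.single i 1) (fun z : E n => f (invariants a x z)) y
      ((ds f (invariants a x y) * perp x y i + dt f (invariants a x y) * perp a y i) * ‖y‖⁻¹) := by
  have h := HasDirDeriv.comp_fin_four (v := EuclideanSpace.single i (1 : ℝ))
    (G := fun z => invariants a x z) hf (.const _)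
    (hasDirDeriv_inner_div_norm i x hy) (.const _) (hasDirDeriv_inner_div_norm i a hy)
  refine h.congr_deriv ?_
  ring

theorem hasDirDeriv_comp_invariants_left (i : Fin n) (a x y : E n)
    {f : (Fin 4 → ℝ) → ℝ} (hf : DifferentiableAt ℝ f (invariants a x y)) :
    HasDirDeriv (EuclideanSpace.single i 1) (fun z : E n => f (invariants a z y)) x
      (2 * du f (invariants a x y) * x i + ds f (invariants a x y) * ell y i
        + dv f (invariants a x y) * a i) := by
  have h := HasDirDeriv.comp_fin_four (v := EuclideanSpace.single i (1 : ℝ))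
    (G := fun z => invariants a z y) hf (hasDirDeriv_norm_sq i x)
    ((hasDirDeriv_inner_left i x y).mul (.const ‖y‖⁻¹)) (hasDirDeriv_inner_right i a x)
    (.const _)
  refine h.congr_deriv ?_
  simp only [ell]
  ring

/-- Closed forms are only available for y ≠ 0. The slit space is open, so they may still be
differentiated, and iterated derivatives can be taken one at a time. -/
theorem dy_eq_of_hasDirDeriv {i : Fin n} {f f₀ : E n → E n → ℝ} {x y : E n} {d : ℝ} (hy : y ≠ 0)
    (hf : ∀ z ≠ 0, f x z = f₀ x z)
    (h : HasDirDeriv (EuclideanSpace.single i 1) (f₀ x) y d) : dy i f x y = d :=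
  (h.congr_of_eventuallyEq
    ((isOpen_ne.eventually_mem hy).mono fun z hz => hf z hz)).fderiv_eq

theorem dx_eq_of_hasDirDeriv {U : Set (E n)} (hU : IsOpen U) {i : Fin n} {f f₀ : E n → E n → ℝ}
    {x y : E n} {d : ℝ} (hx : x ∈ U) (hf : ∀ z ∈ U, f z y = f₀ z y)
    (h : HasDirDeriv (EuclideanSpace.single i 1) (fun z => f₀ z y) x d) : dx i f x y = d :=
  (h.congr_of_eventuallyEq
    ((hU.eventually_mem hx).mono fun z hz => hf z hz)).fderiv_eq

/-! ### Smooth functions of the four invariants -/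

section Smooth

variable {O : Set (Fin 4 → ℝ)} {f g : (Fin 4 → ℝ) → ℝ} {p : Fin 4 → ℝ}

theorem differentiableAt_of_contDiffOn (hO : IsOpen O) (hf : ContDiffOn ℝ ∞ f O) (hp : p ∈ O) :
    DifferentiableAt ℝ f p :=
  (hf.contDiffAt (hO.mem_nhds hp)).differentiableAt (by simp)

theorem contDiffOn_fderiv_apply (hO : IsOpen O) (hf : ContDiffOn ℝ ∞ f O) (w : Fin 4 → ℝ) :
    ContDiffOn ℝ ∞ (fun q => fderiv ℝ f q w) O :=
  (hf.fderiv_of_isOpen hO (m := ∞) (by simp)).clm_apply contDiffOn_const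

theorem contDiffOn_du (hO : IsOpen O) (hf : ContDiffOn ℝ ∞ f O) : ContDiffOn ℝ ∞ (du f) O :=
  contDiffOn_fderiv_apply hO hf _

theorem contDiffOn_ds (hO : IsOpen O) (hf : ContDiffOn ℝ ∞ f O) : ContDiffOn ℝ ∞ (ds f) O :=
  contDiffOn_fderiv_apply hO hf _

theorem contDiffOn_dv (hO : IsOpen O) (hf : ContDiffOn ℝ ∞ f O) : ContDiffOn ℝ ∞ (dv f) O :=
  contDiffOn_fderiv_apply hO hf _

theorem contDiffOn_dt (hO : IsOpen O) (hf : ContDiffOn ℝ ∞ f O) : ContDiffOn ℝ ∞ (dt f) O :=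
  contDiffOn_fderiv_apply hO hf _

theorem contDiffOn_coord (i : Fin 4) : ContDiffOn ℝ ∞ (fun p : Fin 4 → ℝ => p i) O :=
  (contDiff_apply ℝ ℝ i).contDiffOn

theorem fderiv_fderiv_apply_comm (hO : IsOpen O) (hf : ContDiffOn ℝ ∞ f O) (hp : p ∈ O)
    (v w : Fin 4 → ℝ) :
    fderiv ℝ (fun q => fderiv ℝ f q v) p w = fderiv ℝ (fun q => fderiv ℝ f q w) p v := by
  have hd : DifferentiableAt ℝ (fderiv ℝ f) p :=
    ((hf.fderiv_of_isOpen hO (m := ∞) (by simp)).contDiffAt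
      (hO.mem_nhds hp)).differentiableAt (by simp)
  have hs : IsSymmSndFDerivAt ℝ f p :=
    (hf.contDiffAt (hO.mem_nhds hp)).isSymmSndFDerivAt (by simpa using ENat.LEInfty.out)
  have h : ∀ v w : Fin 4 → ℝ,
      fderiv ℝ (fun q => fderiv ℝ f q v) p w = fderiv ℝ (fderiv ℝ f) p w v := by
    intro v w
    rw [fderiv_clm_apply hd (differentiableAt_const v)]
    simp
  rw [h, h, hs]

theorem ds_dt_comm (hO : IsOpen O) (hf : ContDiffOn ℝ ∞ f O) (hp : p ∈ O) :
    ds (dt f) p = dt (ds f) p :=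
  fderiv_fderiv_apply_comm hO hf hp _ _

theorem ds_dv_comm (hO : IsOpen O) (hf : ContDiffOn ℝ ∞ f O) (hp : p ∈ O) :
    ds (dv f) p = dv (ds f) p :=
  fderiv_fderiv_apply_comm hO hf hp _ _

theorem dt_congr (hO : IsOpen O) (h : Set.EqOn f g O) (hp : p ∈ O) : dt f p = dt g p := by
  unfold dt
  rw [(h.eventuallyEq_of_mem (hO.mem_nhds hp)).fderiv_eq]

/-- Mixed derivatives are normalised with `dt` outside `ds`. The inner exchange takes place under a
further `dt`, so it is needed on all of the open set and not only at the point. -/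
theorem ds_dt_dt_comm (hO : IsOpen O) (hf : ContDiffOn ℝ ∞ f O) (hp : p ∈ O) :
    ds (dt (dt f)) p = dt (dt (ds f)) p := by
  rw [ds_dt_comm hO (contDiffOn_dt hO hf) hp]
  exact dt_congr hO (fun q hq => ds_dt_comm hO hf hq) hp

end Smooth

/-! ### Vertical derivatives of `r f` and `r² f` -/

/-- The angular metric `δ - ℓ ⊗ ℓ`. -/
def ang (y : E n) (i j : Fin n) : ℝ := delta i j - ell y i * ell y j

/-- The first vertical derivative of `r f(u, s, v, t)`. -/
def radialD1 (f : (Fin 4 → ℝ) → ℝ) (a x y : E n) (k : Fin n) : ℝ :=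
  f (invariants a x y) * ell y k + ds f (invariants a x y) * perp x y k
    + dt f (invariants a x y) * perp a y k

/-- The second vertical derivative of `r f(u, s, v, t)`. -/
def radialD2 (f : (Fin 4 → ℝ) → ℝ) (a x y : E n) (j k : Fin n) : ℝ :=
  (sigma1 f (invariants a x y) * ang y j k
    + ds (ds f) (invariants a x y) * (perp x y j * perp x y k)
    + dt (ds f) (invariants a x y) * (perp x y j * perp a y k + perp a y j * perp x y k)
    + dt (dt f) (invariants a x y) * (perp a y j * perp a y k)) * ‖y‖⁻¹

/-- The third vertical derivative of `r f(u, s, v, t)`. -/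
def radialD3 (f : (Fin 4 → ℝ) → ℝ) (a x y : E n) (i j k : Fin n) : ℝ :=
  (ds (ds (ds f)) (invariants a x y) * (perp x y i * perp x y j * perp x y k)
    + dt (ds (ds f)) (invariants a x y) * (perp x y i * perp x y j * perp a y k
      + perp x y i * perp a y j * perp x y k + perp a y i * perp x y j * perp x y k)
    + dt (dt (ds f)) (invariants a x y) * (perp x y i * perp a y j * perp a y k
      + perp a y i * perp x y j * perp a y k + perp a y i * perp a y j * perp x y k)
    + dt (dt (dt f)) (invariants a x y) * (perp a y i * perp a y j * perp a y k)
    - (invariants a x y 1 * ds (ds f) (invariants a x y)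
        + invariants a x y 3 * dt (ds f) (invariants a x y))
      * (ang y i j * perp x y k + ang y i k * perp x y j + ang y j k * perp x y i)
    - (invariants a x y 1 * dt (ds f) (invariants a x y)
        + invariants a x y 3 * dt (dt f) (invariants a x y))
      * (ang y i j * perp a y k + ang y i k * perp a y j + ang y j k * perp a y i)) * ‖y‖⁻¹ ^ 2
    - (radialD2 f a x y i j * ell y k + radialD2 f a x y i k * ell y j
      + radialD2 f a x y j k * ell y i) * ‖y‖⁻¹

/-- The first vertical derivative of `r² f(u, s, v, t)`. -/
def radialSqD1 (f : (Fin 4 → ℝ) → ℝ) (a x y : E n) (k : Fin n) : ℝ :=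
  ‖y‖ * (2 * f (invariants a x y) * ell y k + ds f (invariants a x y) * perp x y k
    + dt f (invariants a x y) * perp a y k)

/-- The second vertical derivative of `r² f(u, s, v, t)`. -/
def radialSqD2 (f : (Fin 4 → ℝ) → ℝ) (a x y : E n) (j k : Fin n) : ℝ :=
  2 * f (invariants a x y) * delta j k
    - (invariants a x y 1 * ds f (invariants a x y) + invariants a x y 3 * dt f (invariants a x y))
      * ang y j k
    + ds f (invariants a x y) * (ell y j * perp x y k + perp x y j * ell y k)
    + dt f (invariants a x y) * (ell y j * perp a y k + perp a y j * ell y k)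
    + ds (ds f) (invariants a x y) * (perp x y j * perp x y k)
    + dt (ds f) (invariants a x y) * (perp x y j * perp a y k + perp a y j * perp x y k)
    + dt (dt f) (invariants a x y) * (perp a y j * perp a y k)

/-- The third vertical derivative of `r² f(u, s, v, t)`. -/
def radialSqD3 (f : (Fin 4 → ℝ) → ℝ) (a x y : E n) (i j k : Fin n) : ℝ :=
  (ds (ds (ds f)) (invariants a x y) * (perp x y i * perp x y j * perp x y k)
    + dt (ds (ds f)) (invariants a x y) * (perp x y i * perp x y j * perp a y k
      + perp x y i * perp a y j * perp x y k + perp a y i * perp x y j * perp x y k)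
    + dt (dt (ds f)) (invariants a x y) * (perp x y i * perp a y j * perp a y k
      + perp a y i * perp x y j * perp a y k + perp a y i * perp a y j * perp x y k)
    + dt (dt (dt f)) (invariants a x y) * (perp a y i * perp a y j * perp a y k)
    + (ds f (invariants a x y) - invariants a x y 1 * ds (ds f) (invariants a x y)
        - invariants a x y 3 * dt (ds f) (invariants a x y))
      * (ang y i j * perp x y k + ang y i k * perp x y j + ang y j k * perp x y i)
    + (dt f (invariants a x y) - invariants a x y 1 * dt (ds f) (invariants a x y)
        - invariants a x y 3 * dt (dt f) (invariants a x y))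
      * (ang y i j * perp a y k + ang y i k * perp a y j + ang y j k * perp a y i)) * ‖y‖⁻¹

theorem hasDirDeriv_radial {a x y : E n} (hy : y ≠ 0) {f : (Fin 4 → ℝ) → ℝ}
    (hf : DifferentiableAt ℝ f (invariants a x y)) (k : Fin n) :
    HasDirDeriv (EuclideanSpace.single k 1) (fun z => ‖z‖ * f (invariants a x z)) y
      (radialD1 f a x y k) := by
  have h0 : ‖y‖ ≠ 0 := norm_ne_zero_iff.2 hy
  refine ((hasDirDeriv_norm k hy).mul (hasDirDeriv_comp_invariants k a x hy hf)).congr_deriv ?_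
  simp only [radialD1]
  field_simp
  ring

theorem hasDirDeriv_radialSq {a x y : E n} (hy : y ≠ 0) {f : (Fin 4 → ℝ) → ℝ}
    (hf : DifferentiableAt ℝ f (invariants a x y)) (k : Fin n) :
    HasDirDeriv (EuclideanSpace.single k 1) (fun z => ‖z‖ * (‖z‖ * f (invariants a x z))) y
      (radialSqD1 f a x y k) := by
  have h0 : ‖y‖ ≠ 0 := norm_ne_zero_iff.2 hy
  refine ((hasDirDeriv_norm k hy).mul (hasDirDeriv_radial hy hf k)).congr_deriv ?_
  simp only [radialSqD1, radialD1]
  ring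

section Jets

variable {O : Set (Fin 4 → ℝ)} {f : (Fin 4 → ℝ) → ℝ} {a x y : E n}

/-- The coefficient `sigma1` of m arises from three sources: f from differentiating ℓ, -s f_s from ξ
and -t f_t from η. The remaining ℓ-terms cancel, as they must: r f is 1-homogeneous, so y is a null
vector of its Hessian. -/
theorem hasDirDeriv_radialD1 (hO : IsOpen O) (hf : ContDiffOn ℝ ∞ f O)
    (hp : invariants a x y ∈ O) (hy : y ≠ 0) (j k : Fin n) :
    HasDirDeriv (EuclideanSpace.single j 1) (fun z => radialD1 f a x z k) y
      (radialD2 f a x y j k) := by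
  have hc : ∀ {g}, ContDiffOn ℝ ∞ g O → _ := fun hg =>
    hasDirDeriv_comp_invariants j a x hy (differentiableAt_of_contDiffOn hO hg hp)
  have h := (((hc hf).mul (hasDirDeriv_ell j k hy)).add
    ((hc (contDiffOn_ds hO hf)).mul (hasDirDeriv_perp j k x hy))).add
    ((hc (contDiffOn_dt hO hf)).mul (hasDirDeriv_perp j k a hy))
  refine h.congr_deriv ?_
  rw [ds_dt_comm hO hf hp]
  simp only [radialD2, sigma1, ang, invariants, Matrix.cons_val]
  ring

theorem hasDirDeriv_radialSqD1 (hO : IsOpen O) (hf : ContDiffOn ℝ ∞ f O)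
    (hp : invariants a x y ∈ O) (hy : y ≠ 0) (j k : Fin n) :
    HasDirDeriv (EuclideanSpace.single j 1) (fun z => radialSqD1 f a x z k) y
      (radialSqD2 f a x y j k) := by
  have h0 : ‖y‖ ≠ 0 := norm_ne_zero_iff.2 hy
  have hc : ∀ {g}, ContDiffOn ℝ ∞ g O → _ := fun hg =>
    hasDirDeriv_comp_invariants j a x hy (differentiableAt_of_contDiffOn hO hg hp)
  have h := (hasDirDeriv_norm j hy).mul (((((HasDirDeriv.const 2).mul (hc hf)).mul
    (hasDirDeriv_ell j k hy)).add
    ((hc (contDiffOn_ds hO hf)).mul (hasDirDeriv_perp j k x hy))).add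
    ((hc (contDiffOn_dt hO hf)).mul (hasDirDeriv_perp j k a hy)))
  refine h.congr_deriv ?_
  rw [ds_dt_comm hO hf hp]
  simp only [radialSqD2, ang, invariants, Matrix.cons_val]
  field_simp
  ring

theorem hasDirDeriv_ang (i j k : Fin n) (hy : y ≠ 0) :
    HasDirDeriv (EuclideanSpace.single i 1) (fun z => ang z j k) y
      (-(ang y i j * ell y k + ang y i k * ell y j) * ‖y‖⁻¹) := by
  refine ((HasDirDeriv.const (delta j k)).sub
    ((hasDirDeriv_ell i j hy).mul (hasDirDeriv_ell i k hy))).congr_deriv ?_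
  simp only [ang]
  ring

theorem hasDirDeriv_invariants_one (a x : E n) (i : Fin n) (hy : y ≠ 0) :
    HasDirDeriv (EuclideanSpace.single i 1) (fun z => invariants a x z 1) y
      (perp x y i * ‖y‖⁻¹) :=
  hasDirDeriv_inner_div_norm i x hy

theorem hasDirDeriv_invariants_three (a x : E n) (i : Fin n) (hy : y ≠ 0) :
    HasDirDeriv (EuclideanSpace.single i 1) (fun z => invariants a x z 3) y
      (perp a y i * ‖y‖⁻¹) :=
  hasDirDeriv_inner_div_norm i a hy

/-- The Hessian is (-1)-homogeneous, so contracting the third derivative with y must give minus the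
Hessian. This is why all terms with ℓ collect into copies of `radialD2`. -/
theorem hasDirDeriv_radialD2 (hO : IsOpen O) (hf : ContDiffOn ℝ ∞ f O)
    (hp : invariants a x y ∈ O) (hy : y ≠ 0) (i j k : Fin n) :
    HasDirDeriv (EuclideanSpace.single i 1) (fun z => radialD2 f a x z j k) y
      (radialD3 f a x y i j k) := by
  have h0 : ‖y‖ ≠ 0 := norm_ne_zero_iff.2 hy
  have hc : ∀ {g}, ContDiffOn ℝ ∞ g O → _ := fun hg =>
    hasDirDeriv_comp_invariants i a x hy (differentiableAt_of_contDiffOn hO hg hp)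
  have hs := contDiffOn_ds hO hf
  have ht := contDiffOn_dt hO hf
  have hX := fun k => hasDirDeriv_perp i k x hy
  have hA := fun k => hasDirDeriv_perp i k a hy
  have h := ((((((hc hf).sub ((hasDirDeriv_invariants_one a x i hy).mul (hc hs))).sub
    ((hasDirDeriv_invariants_three a x i hy).mul (hc ht))).mul (hasDirDeriv_ang i j k hy)).add
    ((hc (contDiffOn_ds hO hs)).mul ((hX j).mul (hX k)))).add
    ((hc (contDiffOn_dt hO hs)).mul (((hX j).mul (hA k)).add ((hA j).mul (hX k))))).add
    ((hc (contDiffOn_dt hO ht)).mul ((hA j).mul (hA k)))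
  refine (h.mul ((hasDirDeriv_norm i hy).inv h0)).congr_deriv ?_
  rw [ds_dt_comm hO hs hp, ds_dt_dt_comm hO hf hp, ds_dt_comm hO hf hp]
  simp only [radialD3, radialD2, sigma1, ang, invariants, Matrix.cons_val]
  ring

/-- Here the second derivative is 0-homogeneous, so y annihilates the third derivative and no ℓ
survives in `radialSqD3`. -/
theorem hasDirDeriv_radialSqD2 (hO : IsOpen O) (hf : ContDiffOn ℝ ∞ f O)
    (hp : invariants a x y ∈ O) (hy : y ≠ 0) (i j k : Fin n) :
    HasDirDeriv (EuclideanSpace.single i 1) (fun z => radialSqD2 f a x z j k) y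
      (radialSqD3 f a x y i j k) := by
  have hc : ∀ {g}, ContDiffOn ℝ ∞ g O → _ := fun hg =>
    hasDirDeriv_comp_invariants i a x hy (differentiableAt_of_contDiffOn hO hg hp)
  have hs := contDiffOn_ds hO hf
  have ht := contDiffOn_dt hO hf
  have hX := fun k => hasDirDeriv_perp i k x hy
  have hA := fun k => hasDirDeriv_perp i k a hy
  have hl := fun k => hasDirDeriv_ell i k hy
  have h := (((((((((HasDirDeriv.const 2).mul (hc hf)).mul (.const (delta j k))).sub
    ((((hasDirDeriv_invariants_one a x i hy).mul (hc hs)).add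
    ((hasDirDeriv_invariants_three a x i hy).mul (hc ht))).mul (hasDirDeriv_ang i j k hy))).add
    ((hc hs).mul (((hl j).mul (hX k)).add ((hX j).mul (hl k))))).add
    ((hc ht).mul (((hl j).mul (hA k)).add ((hA j).mul (hl k))))).add
    ((hc (contDiffOn_ds hO hs)).mul ((hX j).mul (hX k)))).add
    ((hc (contDiffOn_dt hO hs)).mul (((hX j).mul (hA k)).add ((hA j).mul (hX k))))).add
    ((hc (contDiffOn_dt hO ht)).mul ((hA j).mul (hA k))))
  refine h.congr_deriv ?_
  rw [ds_dt_comm hO hs hp, ds_dt_dt_comm hO hf hp, ds_dt_comm hO hf hp]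
  simp only [radialSqD3, ang, invariants, Matrix.cons_val]
  ring

end Jets

/-! ### Contractions -/

theorem sum_mul_eq_inner (x y : E n) : ∑ l, x l * y l = inner ℝ x y := by
  rw [PiLp.inner_apply]
  exact Finset.sum_congr rfl fun l _ => by simp [mul_comm]

theorem sum_delta_mul (i : Fin n) (f : Fin n → ℝ) : ∑ l, delta i l * f l = f i := by
  simp [delta]

theorem delta_comm (i j : Fin n) : delta i j = delta j i := by
  simp [delta, eq_comm]

theorem ang_comm (y : E n) (i j : Fin n) : ang y i j = ang y j i := by
  simp only [ang, delta_comm i j]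
  ring

theorem norm_mul_ell {y : E n} (hy : y ≠ 0) (i : Fin n) : ‖y‖ * ell y i = y i := by
  have h0 : ‖y‖ ≠ 0 := norm_ne_zero_iff.2 hy
  simp only [ell]
  field_simp

theorem sum_ell_mul (y z : E n) : ∑ l, ell y l * z l = inner ℝ z y / ‖y‖ := by
  simp only [ell, div_mul_eq_mul_div, ← Finset.sum_div]
  rw [sum_mul_eq_inner, real_inner_comm]

theorem sum_ell_mul_ell {y : E n} (hy : y ≠ 0) : ∑ l, ell y l * ell y l = 1 := by
  have h0 : ‖y‖ ≠ 0 := norm_ne_zero_iff.2 hy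
  have h : ∀ l, ell y l * ell y l = (y l * y l) / ‖y‖ ^ 2 := fun l => by simp only [ell]; ring
  rw [Finset.sum_congr rfl fun l _ => h l, ← Finset.sum_div, sum_mul_eq_inner,
    real_inner_self_eq_norm_sq]
  field_simp

theorem sum_mul_perp (f : Fin n → ℝ) (z y : E n) :
    ∑ l, f l * perp z y l = ∑ l, f l * z l - inner ℝ z y / ‖y‖ * ∑ l, f l * ell y l := by
  simp only [perp, mul_sub, Finset.sum_sub_distrib, Finset.mul_sum]
  congr 1
  exact Finset.sum_congr rfl fun l _ => by ring

theorem sum_ell_mul_perp (z : E n) {y : E n} (hy : y ≠ 0) : ∑ l, ell y l * perp z y l = 0 := by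
  rw [sum_mul_perp, sum_ell_mul, sum_ell_mul_ell hy]
  ring

theorem sum_perp_mul_ell (z : E n) {y : E n} (hy : y ≠ 0) : ∑ l, perp z y l * ell y l = 0 := by
  simpa only [mul_comm] using sum_ell_mul_perp z hy

theorem sum_perp_mul (z w y : E n) :
    ∑ l, perp z y l * w l = inner ℝ z w - inner ℝ z y / ‖y‖ * (inner ℝ w y / ‖y‖) := by
  have h := sum_mul_perp w z y
  simp only [mul_comm (w _)] at h
  rw [h, sum_mul_eq_inner, sum_ell_mul]

theorem sum_perp_mul_perp (z w : E n) {y : E n} (hy : y ≠ 0) :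
    ∑ l, perp z y l * perp w y l
      = inner ℝ z w - inner ℝ z y / ‖y‖ * (inner ℝ w y / ‖y‖) := by
  rw [sum_mul_perp, sum_perp_mul, sum_perp_mul_ell z hy]
  ring

theorem sum_ang_mul (y : E n) (i : Fin n) (f : Fin n → ℝ) :
    ∑ l, ang y i l * f l = f i - ell y i * ∑ l, ell y l * f l := by
  simp only [ang, sub_mul, Finset.sum_sub_distrib, sum_delta_mul, Finset.mul_sum, mul_assoc]

theorem sum_ang_mul_perp (z : E n) {y : E n} (hy : y ≠ 0) (i : Fin n) :
    ∑ l, ang y i l * perp z y l = perp z y i := by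
  rw [sum_ang_mul, sum_ell_mul_perp z hy]
  ring

theorem sum_ang_mul_ell {y : E n} (hy : y ≠ 0) (i : Fin n) : ∑ l, ang y i l * ell y l = 0 := by
  rw [sum_ang_mul, sum_ell_mul_ell hy]
  ring

theorem sum_ang_mul_coord (z y : E n) (i : Fin n) : ∑ l, ang y i l * z l = perp z y i := by
  rw [sum_ang_mul, sum_ell_mul]
  simp only [perp]
  ring

/-- This and the next three lemmas give the Gram matrix of ξ and η, which is how u - s², v - st and
a² - t² enter all later formulas. -/
theorem sum_perp_x_mul_perp_x (a x : E n) {y : E n} (hy : y ≠ 0) :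
    ∑ l, perp x y l * perp x y l = us (invariants a x y) := by
  rw [sum_perp_mul_perp _ _ hy]
  simp only [us, invariants, Matrix.cons_val, real_inner_self_eq_norm_sq]
  ring

theorem sum_perp_x_mul_perp_a (a x : E n) {y : E n} (hy : y ≠ 0) :
    ∑ l, perp x y l * perp a y l = vst (invariants a x y) := by
  rw [sum_perp_mul_perp _ _ hy, real_inner_comm]
  simp only [vst, invariants, Matrix.cons_val]

theorem sum_perp_a_mul_perp_x (a x : E n) {y : E n} (hy : y ≠ 0) :
    ∑ l, perp a y l * perp x y l = vst (invariants a x y) := by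
  simpa only [mul_comm] using sum_perp_x_mul_perp_a a x hy

theorem sum_perp_a_mul_perp_a (a x : E n) {y : E n} (hy : y ≠ 0) :
    ∑ l, perp a y l * perp a y l = at2 (‖a‖ ^ 2) (invariants a x y) := by
  rw [sum_perp_mul_perp _ _ hy]
  simp only [at2, invariants, Matrix.cons_val, real_inner_self_eq_norm_sq]
  ring

theorem sum_linear_comb_four_mul {ι : Type*} [Fintype ι] (c₁ c₂ c₃ c₄ : ℝ)
    (t₁ t₂ t₃ t₄ z : ι → ℝ) :
    ∑ j, (c₁ * t₁ j + c₂ * t₂ j + c₃ * t₃ j + c₄ * t₄ j) * z j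
      = c₁ * ∑ j, t₁ j * z j + c₂ * ∑ j, t₂ j * z j + c₃ * ∑ j, t₃ j * z j
        + c₄ * ∑ j, t₄ j * z j := by
  simp only [Finset.mul_sum, ← Finset.sum_add_distrib]
  exact Finset.sum_congr rfl fun j _ => by ring

theorem sum_mul_linear_comb_three {ι : Type*} [Fintype ι] (c₁ c₂ c₃ : ℝ)
    (t₁ t₂ t₃ z : ι → ℝ) :
    ∑ j, z j * (c₁ * t₁ j + c₂ * t₂ j + c₃ * t₃ j)
      = c₁ * ∑ j, z j * t₁ j + c₂ * ∑ j, z j * t₂ j + c₃ * ∑ j, z j * t₃ j := by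
  simp only [Finset.mul_sum, ← Finset.sum_add_distrib]
  exact Finset.sum_congr rfl fun j _ => by ring

/-! ### The fundamental tensor -/

section Fundamental

variable {O : Set (Fin 4 → ℝ)} {φ : (Fin 4 → ℝ) → ℝ} {a x y : E n}

theorem dy_metric (hO : IsOpen O) (hφ : ContDiffOn ℝ ∞ φ O) (hp : invariants a x y ∈ O)
    (hy : y ≠ 0) (j : Fin n) : dy j (metric φ a) x y = radialD1 φ a x y j :=
  (hasDirDeriv_radial hy (differentiableAt_of_contDiffOn hO hφ hp) j).fderiv_eq

theorem dy_metric_sq (hO : IsOpen O) (hφ : ContDiffOn ℝ ∞ φ O) (hp : invariants a x y ∈ O)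
    (hy : y ≠ 0) (j : Fin n) :
    dy j (fun x y => metric φ a x y ^ 2) x y
      = 2 * (‖y‖ * φ (invariants a x y) * radialD1 φ a x y j) := by
  have h := hasDirDeriv_radial hy (differentiableAt_of_contDiffOn hO hφ hp) j
  have h2 := (h.mul h).fderiv_eq
  simp only [dy, metric, pow_two]
  rw [h2]
  ring

theorem fundamental_apply (hO : IsOpen O) (hφ : ContDiffOn ℝ ∞ φ O)
    (hp : ∀ z : E n, z ≠ 0 → invariants a x z ∈ O) (hy : y ≠ 0) (i j : Fin n) :
    fundamental (metric φ a) x y i j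
      = ‖y‖ * φ (invariants a x y) * radialD2 φ a x y i j
        + radialD1 φ a x y i * radialD1 φ a x y j := by
  have h := ((HasDirDeriv.const 2).mul
    ((hasDirDeriv_radial hy (differentiableAt_of_contDiffOn hO hφ (hp y hy)) i).mul
      (hasDirDeriv_radialD1 hO hφ (hp y hy) hy i j)))
  simp only [fundamental, Matrix.of_apply]
  rw [dy_eq_of_hasDirDeriv (f₀ := fun x z => 2 * (‖z‖ * φ (invariants a x z) * radialD1 φ a x z j))
    hy (fun z hz => dy_metric_sq hO hφ (hp z hz) hz j) h]
  ring

theorem fundamental_apply_eq (hO : IsOpen O) (hφ : ContDiffOn ℝ ∞ φ O)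
    (hp : ∀ z : E n, z ≠ 0 → invariants a x z ∈ O) (hy : y ≠ 0) (i j : Fin n) :
    fundamental (metric φ a) x y i j
      = c0 φ (invariants a x y) * ang y i j
        + φ (invariants a x y) * (ds (ds φ) (invariants a x y) * (perp x y i * perp x y j)
          + dt (ds φ) (invariants a x y) * (perp x y i * perp a y j + perp a y i * perp x y j)
          + dt (dt φ) (invariants a x y) * (perp a y i * perp a y j))
        + radialD1 φ a x y i * radialD1 φ a x y j := by
  have h0 : ‖y‖ ≠ 0 := norm_ne_zero_iff.2 hy
  rw [fundamental_apply hO hφ hp hy]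
  simp only [radialD2, c0, sigma1]
  field_simp
  ring

theorem fundamental_comm (hO : IsOpen O) (hφ : ContDiffOn ℝ ∞ φ O)
    (hp : ∀ z : E n, z ≠ 0 → invariants a x z ∈ O) (hy : y ≠ 0) (i j : Fin n) :
    fundamental (metric φ a) x y i j = fundamental (metric φ a) x y j i := by
  rw [fundamental_apply_eq hO hφ hp hy, fundamental_apply_eq hO hφ hp hy, ang_comm]
  ring

/-- For fixed i the row is a combination of m, ξ, η, ℓ in the index j, the shape needed by
`sum_linear_comb_four_mul`. -/
theorem fundamental_row (hO : IsOpen O) (hφ : ContDiffOn ℝ ∞ φ O)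
    (hp : ∀ z : E n, z ≠ 0 → invariants a x z ∈ O) (hy : y ≠ 0) (i j : Fin n) :
    fundamental (metric φ a) x y i j
      = c0 φ (invariants a x y) * ang y i j
        + (φ (invariants a x y) * (ds (ds φ) (invariants a x y) * perp x y i
            + dt (ds φ) (invariants a x y) * perp a y i)
          + radialD1 φ a x y i * ds φ (invariants a x y)) * perp x y j
        + (φ (invariants a x y) * (dt (ds φ) (invariants a x y) * perp x y i
            + dt (dt φ) (invariants a x y) * perp a y i)
          + radialD1 φ a x y i * dt φ (invariants a x y)) * perp a y j
        + radialD1 φ a x y i * φ (invariants a x y) * ell y j := by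
  rw [fundamental_apply_eq hO hφ hp hy]
  simp only [radialD1]
  ring

/-- The fundamental tensor applied to a combination of `x`, `a` and `y`. -/
theorem sum_fundamental_mul (hO : IsOpen O) (hφ : ContDiffOn ℝ ∞ φ O)
    (hp : ∀ z : E n, z ≠ 0 → invariants a x z ∈ O) (hy : y ≠ 0) (i : Fin n) (α β κ : ℝ) :
    ∑ j, fundamental (metric φ a) x y i j * (α * perp x y j + β * perp a y j + κ * ell y j)
      = φ (invariants a x y)
          * (sigma1 φ (invariants a x y) * α
            + ds (ds φ) (invariants a x y)
              * (us (invariants a x y) * α + vst (invariants a x y) * β)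
            + dt (ds φ) (invariants a x y)
              * (vst (invariants a x y) * α + at2 (‖a‖ ^ 2) (invariants a x y) * β))
          * perp x y i
        + φ (invariants a x y)
          * (sigma1 φ (invariants a x y) * β
            + dt (ds φ) (invariants a x y)
              * (us (invariants a x y) * α + vst (invariants a x y) * β)
            + dt (dt φ) (invariants a x y)
              * (vst (invariants a x y) * α + at2 (‖a‖ ^ 2) (invariants a x y) * β))
          * perp a y i
        + (φ (invariants a x y) * κ
            + ds φ (invariants a x y)
              * (us (invariants a x y) * α + vst (invariants a x y) * β)
            + dt φ (invariants a x y)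
              * (vst (invariants a x y) * α + at2 (‖a‖ ^ 2) (invariants a x y) * β))
          * radialD1 φ a x y i := by
  simp only [fundamental_row hO hφ hp hy]
  rw [sum_linear_comb_four_mul]
  simp only [sum_mul_linear_comb_three, sum_ang_mul_perp _ hy, sum_ang_mul_ell hy,
    sum_perp_x_mul_perp_x a x hy, sum_perp_x_mul_perp_a a x hy, sum_perp_a_mul_perp_x a x hy,
    sum_perp_a_mul_perp_a a x hy, sum_perp_mul_ell _ hy, sum_ell_mul_perp _ hy,
    sum_ell_mul_ell hy]
  simp only [c0, sigma1]
  ring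

end Fundamental

/-! ### Nondegeneracy -/

/-- Replaces any computation of g⁻¹: a candidate z for g⁻¹b is checked by evaluating gz. -/
theorem sum_inv_mul_of_sum_mul {M : Matrix (Fin n) (Fin n) ℝ} (hM : M.PosDef) {z b : Fin n → ℝ}
    (h : ∀ i, ∑ j, M i j * z j = b i) (i : Fin n) : ∑ j, M⁻¹ i j * b j = z i := by
  have hb : b = M.mulVec z := funext fun i => (h i).symm
  have hz : M⁻¹.mulVec b = z := by
    rw [hb, Matrix.mulVec_mulVec,
      Matrix.nonsing_inv_mul _ ((Matrix.isUnit_iff_isUnit_det _).1 hM.isUnit), Matrix.one_mulVec]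
  exact congrFun hz i

theorem eq_zero_of_sum_mul_eq_zero {M : Matrix (Fin n) (Fin n) ℝ} (hM : M.PosDef) {z : Fin n → ℝ}
    (h : ∀ i, ∑ j, M i j * z j = 0) (i : Fin n) : z i = 0 := by
  rw [← sum_inv_mul_of_sum_mul hM (b := fun _ => 0) h i]
  simp

theorem hasDerivAt_along_line {f : E n → ℝ} {y e : E n} {d : Fin n → ℝ} {τ : ℝ} (i₀ : Fin n)
    (h : ∀ i, HasDirDeriv (EuclideanSpace.single i 1) f (y + τ • e) (d i)) :
    HasDerivAt (fun τ : ℝ => f (y + τ • e)) (∑ i, d i * e i) τ := by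
  -- The index `i₀` only supplies differentiability; uniqueness of the derivative then identifies
  -- its value on every basis vector.
  obtain ⟨L, hL, -⟩ := h i₀
  have hd : ∀ i, L (EuclideanSpace.single i 1) = d i := fun i => by
    rw [← (h i).fderiv_eq, hL.fderiv]
  have hγ : HasDerivAt (fun τ : ℝ => y + τ • e) e τ := by
    simpa using ((hasDerivAt_id τ).smul_const e).const_add y
  have he : L e = ∑ i, d i * e i := by
    have : e = ∑ i, e i • EuclideanSpace.single i (1 : ℝ) := by
      simpa using ((EuclideanSpace.basisFun (Fin n) ℝ).sum_repr e).symm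
    conv_lhs => rw [this]
    simp [map_sum, hd, mul_comm]
  rw [← he]
  exact hL.comp_hasDerivAt τ hγ

theorem exists_ne_zero_inner_eq_zero (hn : 3 ≤ n) (x a : E n) :
    ∃ e : E n, e ≠ 0 ∧ inner ℝ x e = 0 ∧ inner ℝ a e = 0 := by
  let f : E n →ₗ[ℝ] ℝ × ℝ :=
    ((innerSL ℝ x : E n →L[ℝ] ℝ) : E n →ₗ[ℝ] ℝ).prod ((innerSL ℝ a : E n →L[ℝ] ℝ) : E n →ₗ[ℝ] ℝ)
  have hker : LinearMap.ker f ≠ ⊥ := by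
    apply LinearMap.ker_ne_bot_of_finrank_lt
    simp
    omega
  obtain ⟨e, he, h0⟩ := Submodule.exists_mem_ne_zero_of_ne_bot hker
  have h : f e = 0 := he
  exact ⟨e, h0, congrArg Prod.fst h, congrArg Prod.snd h⟩

section

variable {O : Set (Fin 4 → ℝ)} {φ : (Fin 4 → ℝ) → ℝ} {a x y : E n}

/-- Since gℓ = φ F_y, a zero of φ would put the unit vector ℓ in the kernel of g. -/
theorem phi_ne_zero (hO : IsOpen O) (hφ : ContDiffOn ℝ ∞ φ O)
    (hp : ∀ z : E n, z ≠ 0 → invariants a x z ∈ O) (hy : y ≠ 0)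
    (hg : (fundamental (metric φ a) x y).PosDef) : φ (invariants a x y) ≠ 0 := by
  intro h0
  have h : ∀ i, ell y i = 0 := eq_zero_of_sum_mul_eq_zero hg fun i => by
    have := sum_fundamental_mul hO hφ hp hy i 0 0 1
    simpa [h0] using this
  have := sum_ell_mul_ell hy
  simp [h] at this

/-- This is g(e,e), the second derivative of F²/2 along e. For e orthogonal to x and a the first
derivative is c₀⟨e,y⟩, and the right side is written so as to match the derivative of that product.
-/
theorem sum_fundamental_mul_of_inner_eq_zero (hO : IsOpen O) (hφ : ContDiffOn ℝ ∞ φ O)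
    (hp : ∀ z : E n, z ≠ 0 → invariants a x z ∈ O) (hy : y ≠ 0) {e : E n}
    (hx : inner ℝ x e = 0) (ha : inner ℝ a e = 0) :
    ∑ i, (∑ j, fundamental (metric φ a) x y i j * e j) * e i
      = c0 φ (invariants a x y) * ‖e‖ ^ 2
        + (-sigma1 φ (invariants a x y) * (invariants a x y 1 * ds φ (invariants a x y)
            + invariants a x y 3 * dt φ (invariants a x y))
          + φ (invariants a x y) * (invariants a x y 1 ^ 2 * ds (ds φ) (invariants a x y)
            + 2 * invariants a x y 1 * invariants a x y 3 * dt (ds φ) (invariants a x y)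
            + invariants a x y 3 ^ 2 * dt (dt φ) (invariants a x y)))
          * (inner ℝ e y / ‖y‖) ^ 2 := by
  have hX : ∑ j, perp x y j * e j = -(invariants a x y 1 * (inner ℝ e y / ‖y‖)) := by
    rw [sum_perp_mul, hx]
    simp [invariants]
  have hA : ∑ j, perp a y j * e j = -(invariants a x y 3 * (inner ℝ e y / ‖y‖)) := by
    rw [sum_perp_mul, ha]
    simp [invariants]
  have hE : ∑ j, perp e y j * e j = ‖e‖ ^ 2 - (inner ℝ e y / ‖y‖) ^ 2 := by
    rw [sum_perp_mul, real_inner_self_eq_norm_sq]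
    ring
  have hrow : ∀ i, ∑ j, fundamental (metric φ a) x y i j * e j
      = c0 φ (invariants a x y) * perp e y i
      + (-φ (invariants a x y) * (invariants a x y 1 * ds (ds φ) (invariants a x y)
          + invariants a x y 3 * dt (ds φ) (invariants a x y))
        + sigma1 φ (invariants a x y) * ds φ (invariants a x y)) * (inner ℝ e y / ‖y‖) * perp x y i
      + (-φ (invariants a x y) * (invariants a x y 1 * dt (ds φ) (invariants a x y)
          + invariants a x y 3 * dt (dt φ) (invariants a x y))
        + sigma1 φ (invariants a x y) * dt φ (invariants a x y)) * (inner ℝ e y / ‖y‖) * perp a y i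
      + sigma1 φ (invariants a x y) * φ (invariants a x y) * (inner ℝ e y / ‖y‖) * ell y i := by
    intro i
    simp only [fundamental_row hO hφ hp hy, sum_linear_comb_four_mul, sum_ang_mul_coord, hX, hA,
      sum_ell_mul, radialD1, sigma1]
    ring
  simp only [hrow]
  rw [sum_linear_comb_four_mul, hX, hA, hE, sum_ell_mul]
  simp only [c0, sigma1]
  ring

theorem sum_fundamental_mul_self_pos (hg : (fundamental (metric φ a) x y).PosDef) {e : E n}
    (he : e ≠ 0) : 0 < ∑ i, (∑ j, fundamental (metric φ a) x y i j * e j) * e i := by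
  have h := hg.dotProduct_mulVec_pos (x := fun i => e i) (fun h => he (by
    ext i
    exact congrFun h i))
  simpa only [dotProduct, Matrix.mulVec, star_trivial, mul_comm (e _)] using h

theorem hasDirDeriv_c0 (hO : IsOpen O) (hφ : ContDiffOn ℝ ∞ φ O) (hp : invariants a x y ∈ O)
    (hy : y ≠ 0) (i : Fin n) :
    HasDirDeriv (EuclideanSpace.single i 1) (fun z => c0 φ (invariants a x z)) y
      ((sigma1 φ (invariants a x y) * ds φ (invariants a x y)
          - φ (invariants a x y) * (invariants a x y 1 * ds (ds φ) (invariants a x y)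
            + invariants a x y 3 * dt (ds φ) (invariants a x y))) * ‖y‖⁻¹ * perp x y i
        + (sigma1 φ (invariants a x y) * dt φ (invariants a x y)
          - φ (invariants a x y) * (invariants a x y 1 * dt (ds φ) (invariants a x y)
            + invariants a x y 3 * dt (dt φ) (invariants a x y))) * ‖y‖⁻¹ * perp a y i) := by
  have hc : ∀ {g}, ContDiffOn ℝ ∞ g O → _ := fun hg =>
    hasDirDeriv_comp_invariants i a x hy (differentiableAt_of_contDiffOn hO hg hp)
  have h := (hc hφ).mul (((hc hφ).sub ((hasDirDeriv_invariants_one a x i hy).mul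
    (hc (contDiffOn_ds hO hφ)))).sub ((hasDirDeriv_invariants_three a x i hy).mul
    (hc (contDiffOn_dt hO hφ))))
  have heq : (fun z => c0 φ (invariants a x z)) = fun z => φ (invariants a x z) *
      (φ (invariants a x z) - invariants a x z 1 * ds φ (invariants a x z)
        - invariants a x z 3 * dt φ (invariants a x z)) := by
    funext z
    simp only [c0]
    ring
  rw [heq]
  refine h.congr_deriv ?_
  rw [ds_dt_comm hO hφ hp]
  simp only [sigma1]
  ring

/-- For n ≥ 3 some e ≠ 0 is orthogonal to x and a. Along y + τe the function c₀⟨e, y + τe⟩ is the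
derivative of F²/2, and its own derivative is g(e,e) > 0. Being strictly increasing, it vanishes
only once, and the factor ⟨e, y + τe⟩ already accounts for that zero. -/
theorem c0_ne_zero_of_three_le (hn : 3 ≤ n) (hO : IsOpen O) (hφ : ContDiffOn ℝ ∞ φ O)
    (hp : ∀ z : E n, z ≠ 0 → invariants a x z ∈ O)
    (hg : ∀ z : E n, z ≠ 0 → (fundamental (metric φ a) x z).PosDef) (hy : y ≠ 0) :
    c0 φ (invariants a x y) ≠ 0 := by
  obtain ⟨e, he, hx, ha⟩ := exists_ne_zero_inner_eq_zero hn x a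
  -- If the line meets the origin, where F² need not be smooth, then y is a multiple of e; hence s =
  -- t = 0 and c₀ = φ².
  by_cases hline : ∃ τ : ℝ, y + τ • e = 0
  · obtain ⟨τ, hτ⟩ := hline
    have hy' : y = (-τ) • e := by
      rw [neg_smul]
      exact eq_neg_of_add_eq_zero_left hτ
    have h1 : invariants a x y 1 = 0 := by
      simp [invariants, hy', inner_smul_right, hx]
    have h3 : invariants a x y 3 = 0 := by
      simp [invariants, hy', inner_smul_right, ha]
    have hφ0 := phi_ne_zero hO hφ hp hy (hg y hy)
    simpa [c0, h1, h3] using hφ0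
  · push Not at hline
    have hmono : StrictMono fun τ : ℝ =>
        c0 φ (invariants a x (y + τ • e)) * (inner ℝ e y + τ * ‖e‖ ^ 2) := by
      refine strictMono_of_hasDerivAt_pos (f' := fun τ =>
        ∑ i, (∑ j, fundamental (metric φ a) x (y + τ • e) i j * e j) * e i) ?_
        fun τ => sum_fundamental_mul_self_pos (hg _ (hline τ)) he
      intro τ
      have hz := hline τ
      have h1 := hasDerivAt_along_line (⟨0, by omega⟩ : Fin n)
        (fun i => hasDirDeriv_c0 hO hφ (hp _ hz) hz i)
      have h2 : HasDerivAt (fun τ : ℝ => inner ℝ e y + τ * ‖e‖ ^ 2) (‖e‖ ^ 2) τ := by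
        simpa using ((hasDerivAt_id τ).mul_const (‖e‖ ^ 2)).const_add (inner ℝ e y)
      have h12 := h1.mul h2
      have hin : inner ℝ e y + τ * ‖e‖ ^ 2 = inner ℝ e (y + τ • e) := by
        rw [inner_add_right, inner_smul_right, real_inner_self_eq_norm_sq]
      refine h12.congr_deriv ?_
      rw [hin, sum_fundamental_mul_of_inner_eq_zero hO hφ hp hz hx ha]
      generalize y + τ • e = z at *
      have h0 : ‖z‖ ≠ 0 := norm_ne_zero_iff.2 hz
      have hX : ∑ j, perp x z j * e j = -(invariants a x z 1 * (inner ℝ e z / ‖z‖)) := by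
        rw [sum_perp_mul, hx]
        simp [invariants]
      have hA : ∑ j, perp a z j * e j = -(invariants a x z 3 * (inner ℝ e z / ‖z‖)) := by
        rw [sum_perp_mul, ha]
        simp [invariants]
      simp only [add_mul, Finset.sum_add_distrib, mul_assoc, ← Finset.mul_sum, hX, hA]
      field_simp
      ring
    intro hc
    -- If ⟨e,y⟩ = 0 then g(e,e) = c₀|e|² decides at once. Otherwise c₀ = 0 would give the increasing
    -- function two zeros, at τ = 0 and at the τ where ⟨e, y + τe⟩ = 0.
    by_cases hey : inner ℝ e y = 0
    · have h := sum_fundamental_mul_self_pos (hg y hy) he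
      rw [sum_fundamental_mul_of_inner_eq_zero hO hφ hp hy hx ha, hc, hey] at h
      simp at h
    · have hne : (0 : ℝ) ≠ -inner ℝ e y / ‖e‖ ^ 2 := by
        have : ‖e‖ ≠ 0 := norm_ne_zero_iff.2 he
        intro h
        field_simp at h
        apply hey
        linarith
      apply hne
      apply hmono.injective
      have : ‖e‖ ≠ 0 := norm_ne_zero_iff.2 he
      simp only [zero_smul, add_zero, hc, zero_mul]
      field_simp
      ring

/-- The number ρ is the determinant of the 2×2 matrix N describing g on ξ and η, so it suffices that
N has trivial kernel. As ξ and η may be linearly dependent, this does not follow from injectivity of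
g alone; σ₁ ≠ 0 is used as well. -/
theorem rho_ne_zero (hO : IsOpen O) (hφ : ContDiffOn ℝ ∞ φ O)
    (hp : ∀ z : E n, z ≠ 0 → invariants a x z ∈ O) (hy : y ≠ 0)
    (hg : (fundamental (metric φ a) x y).PosDef) (hc : c0 φ (invariants a x y) ≠ 0) :
    rho φ (‖a‖ ^ 2) (invariants a x y) ≠ 0 := by
  have hφ0 := phi_ne_zero hO hφ hp hy hg
  have hs : sigma1 φ (invariants a x y) ≠ 0 := by
    rintro h
    apply hc
    rw [show c0 φ (invariants a x y) = φ (invariants a x y) * sigma1 φ (invariants a x y) by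
      simp only [c0, sigma1]; ring, h, mul_zero]
  have hker : ∀ α β : ℝ,
      sigma1 φ (invariants a x y) * α
        + ds (ds φ) (invariants a x y)
          * (us (invariants a x y) * α + vst (invariants a x y) * β)
        + dt (ds φ) (invariants a x y)
          * (vst (invariants a x y) * α + at2 (‖a‖ ^ 2) (invariants a x y) * β) = 0 →
      sigma1 φ (invariants a x y) * β
        + dt (ds φ) (invariants a x y)
          * (us (invariants a x y) * α + vst (invariants a x y) * β)
        + dt (dt φ) (invariants a x y)
          * (vst (invariants a x y) * α + at2 (‖a‖ ^ 2) (invariants a x y) * β) = 0 →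
      α = 0 ∧ β = 0 := by
    intro α β h1 h2
    -- With this κ the F_y-component of gz vanishes too, so that gz = 0 and z = 0.
    obtain ⟨κ, hκ⟩ : ∃ κ, φ (invariants a x y) * κ
        + ds φ (invariants a x y) * (us (invariants a x y) * α + vst (invariants a x y) * β)
        + dt φ (invariants a x y)
          * (vst (invariants a x y) * α + at2 (‖a‖ ^ 2) (invariants a x y) * β) = 0 :=
      ⟨-(ds φ (invariants a x y) * (us (invariants a x y) * α + vst (invariants a x y) * β)
        + dt φ (invariants a x y)
          * (vst (invariants a x y) * α + at2 (‖a‖ ^ 2) (invariants a x y) * β))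
        / φ (invariants a x y), by field_simp; ring⟩
    have hz := eq_zero_of_sum_mul_eq_zero hg
      (z := fun j => α * perp x y j + β * perp a y j + κ * ell y j) fun i => by
        rw [sum_fundamental_mul hO hφ hp hy, h1, h2, hκ]
        ring
    -- Pairing z = 0 with ξ and η shows that the Gram matrix kills (α,β). Then N(α,β) reduces to
    -- σ₁(α,β), and σ₁ ≠ 0 finishes.
    have hX : ∑ j, perp x y j * (α * perp x y j + β * perp a y j + κ * ell y j) = 0 :=
      Finset.sum_eq_zero fun j _ => by rw [hz j, mul_zero]
    have hA : ∑ j, perp a y j * (α * perp x y j + β * perp a y j + κ * ell y j) = 0 :=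
      Finset.sum_eq_zero fun j _ => by rw [hz j, mul_zero]
    simp only [sum_mul_linear_comb_three, sum_perp_x_mul_perp_x a x hy,
      sum_perp_x_mul_perp_a a x hy, sum_perp_a_mul_perp_x a x hy, sum_perp_a_mul_perp_a a x hy,
      sum_perp_mul_ell _ hy, mul_zero, add_zero] at hX hA
    have hX' : us (invariants a x y) * α + vst (invariants a x y) * β = 0 := by linarith
    have hA' : vst (invariants a x y) * α + at2 (‖a‖ ^ 2) (invariants a x y) * β = 0 := by linarith
    rw [hX', hA'] at h1 h2
    simpa [hs] using And.intro h1 h2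
  intro hρ
  simp only [rho, hess] at hρ
  generalize sigma1 φ (invariants a x y) = σ at *
  generalize us (invariants a x y) = p at *
  generalize vst (invariants a x y) = q at *
  generalize at2 (‖a‖ ^ 2) (invariants a x y) = w at *
  generalize ds (ds φ) (invariants a x y) = b at *
  generalize dt (ds φ) (invariants a x y) = c at *
  generalize dt (dt φ) (invariants a x y) = d at *
  -- The arguments are the columns of the adjugate of N, which N maps to multiples of ρ = 0. So the
  -- adjugate is zero, N itself is zero, and (1,0) lies in the trivial kernel.
  have h1 := hker (σ + q * c + w * d) (-(p * c + q * d)) (by linear_combination hρ) (by ring)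
  have h2 := hker (-(q * b + w * c)) (σ + p * b + q * c) (by ring) (by linear_combination hρ)
  have h3 := hker 1 0 (by linear_combination h2.2) (by linear_combination -h1.2)
  exact one_ne_zero h3.1

end

/-! ### The geodesic spray -/

section

variable {O : Set (Fin 4 → ℝ)} {φ : (Fin 4 → ℝ) → ℝ} {a x y : E n}

theorem dx_metric_sq (hO : IsOpen O) (hφ : ContDiffOn ℝ ∞ φ O) (hp : invariants a x y ∈ O)
    (k : Fin n) :
    dx k (fun x y => metric φ a x y ^ 2) x y
      = 2 * (‖y‖ * φ (invariants a x y) * (‖y‖ * (2 * du φ (invariants a x y) * x k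
        + ds φ (invariants a x y) * ell y k + dv φ (invariants a x y) * a k))) := by
  have h := (HasDirDeriv.const ‖y‖).mul (hasDirDeriv_comp_invariants_left k a x y
    (differentiableAt_of_contDiffOn hO hφ hp))
  have h2 := (h.mul h).fderiv_eq
  simp only [dx, metric, pow_two]
  rw [h2]
  ring

theorem dy_dx_metric_sq (hO : IsOpen O) (hφ : ContDiffOn ℝ ∞ φ O)
    (hp : ∀ z : E n, z ≠ 0 → invariants a x z ∈ O) (hy : y ≠ 0) (l k : Fin n) :
    dy l (dx k fun x y => metric φ a x y ^ 2) x y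
      = 2 * radialD1 φ a x y l * (‖y‖ * (2 * du φ (invariants a x y) * x k
          + ds φ (invariants a x y) * ell y k + dv φ (invariants a x y) * a k))
        + 2 * (‖y‖ * φ (invariants a x y))
          * (2 * (du φ (invariants a x y) * ell y l + ds (du φ) (invariants a x y) * perp x y l
              + dt (du φ) (invariants a x y) * perp a y l) * x k
            + (ds (ds φ) (invariants a x y) * perp x y l + dt (ds φ) (invariants a x y) * perp a y l)
              * ell y k
            + ds φ (invariants a x y) * delta l k
            + (dv φ (invariants a x y) * ell y l + dv (ds φ) (invariants a x y) * perp x y l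
              + dt (dv φ) (invariants a x y) * perp a y l) * a k) := by
  have h0 : ‖y‖ ≠ 0 := norm_ne_zero_iff.2 hy
  have hc : ∀ {g}, ContDiffOn ℝ ∞ g O → _ := fun hg =>
    hasDirDeriv_comp_invariants l a x hy (differentiableAt_of_contDiffOn hO hg (hp y hy))
  have h := (HasDirDeriv.const 2).mul
    ((hasDirDeriv_radial hy (differentiableAt_of_contDiffOn hO hφ (hp y hy)) l).mul
      ((hasDirDeriv_norm l hy).mul (((((HasDirDeriv.const 2).mul
        (hc (contDiffOn_du hO hφ))).mul (.const (x k))).add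
        ((hc (contDiffOn_ds hO hφ)).mul (hasDirDeriv_ell l k hy))).add
        ((hc (contDiffOn_dv hO hφ)).mul (.const (a k))))))
  rw [dy_eq_of_hasDirDeriv (f₀ := fun x z => 2 * (‖z‖ * φ (invariants a x z) *
    (‖z‖ * (2 * du φ (invariants a x z) * x k
        + ds φ (invariants a x z) * ell z k + dv φ (invariants a x z) * a k))))
    hy (fun z hz => dx_metric_sq hO hφ (hp z hz) k) h, ds_dv_comm hO hφ (hp y hy)]
  field_simp
  ring

/-- After x = ξ + sℓ and a = η + tℓ the free ℓ-terms cancel. What remains is a combination of ξ, η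
and F_y, exactly the form in which `sum_fundamental_mul` expresses gz. -/
theorem spray_numerator (hO : IsOpen O) (hφ : ContDiffOn ℝ ∞ φ O)
    (hp : ∀ z : E n, z ≠ 0 → invariants a x z ∈ O) (hy : y ≠ 0) (l : Fin n) :
    (∑ k, dy l (dx k fun x y => metric φ a x y ^ 2) x y * y k)
        - dx l (fun x y => metric φ a x y ^ 2) x y
      = 2 * ‖y‖ ^ 2 * (φ (invariants a x y) * (lam φ (invariants a x y) * perp x y l
            + mu φ (invariants a x y) * perp a y l)
          + (2 * invariants a x y 1 * du φ (invariants a x y) + ds φ (invariants a x y)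
            + invariants a x y 3 * dv φ (invariants a x y)) * radialD1 φ a x y l) := by
  have h0 : ‖y‖ ≠ 0 := norm_ne_zero_iff.2 hy
  have hrow : ∀ k, dy l (dx k fun x y => metric φ a x y ^ 2) x y
      = (4 * ‖y‖ * (radialD1 φ a x y l * du φ (invariants a x y)
            + φ (invariants a x y) * (du φ (invariants a x y) * ell y l
              + ds (du φ) (invariants a x y) * perp x y l
              + dt (du φ) (invariants a x y) * perp a y l))) * x k
        + (2 * ‖y‖ * (radialD1 φ a x y l * ds φ (invariants a x y)
            + φ (invariants a x y) * (ds (ds φ) (invariants a x y) * perp x y l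
              + dt (ds φ) (invariants a x y) * perp a y l))) * ell y k
        + (2 * ‖y‖ * φ (invariants a x y) * ds φ (invariants a x y)) * delta l k
        + (2 * ‖y‖ * (radialD1 φ a x y l * dv φ (invariants a x y)
            + φ (invariants a x y) * (dv φ (invariants a x y) * ell y l
              + dv (ds φ) (invariants a x y) * perp x y l
              + dt (dv φ) (invariants a x y) * perp a y l))) * a k := by
    intro k
    rw [dy_dx_metric_sq hO hφ hp hy]
    ring
  have hs : inner ℝ x y = ‖y‖ * invariants a x y 1 := by
    simp only [invariants, Matrix.cons_val]
    field_simp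
  have ht : inner ℝ a y = ‖y‖ * invariants a x y 3 := by
    simp only [invariants, Matrix.cons_val]
    field_simp
  have hx : x l = perp x y l + invariants a x y 1 * ell y l := by
    simp only [perp, invariants, Matrix.cons_val]
    ring
  have ha : a l = perp a y l + invariants a x y 3 * ell y l := by
    simp only [perp, invariants, Matrix.cons_val]
    ring
  have hr : inner ℝ y y / ‖y‖ = ‖y‖ := by
    rw [real_inner_self_eq_norm_sq]
    field_simp
  simp only [hrow, sum_linear_comb_four_mul, sum_mul_eq_inner, sum_ell_mul, sum_delta_mul, hr]
  rw [dx_metric_sq hO hφ (hp y hy), hs, ht, hx, ha, ← norm_mul_ell hy l]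
  simp only [lam, mu]
  ring

/-- The candidate for g⁻¹ of the numerator is 4r²(Qξ + Rη + (P + sQ + tR)ℓ). Its ξ- and η-components
form a linear system with determinant ρ, solved by Q and R through Cramer's rule; the F_y-component
is the definition of P. If ξ = η = 0 only the last equation is needed and the values of Q and R are
irrelevant, even where ρ = 0. -/
theorem spray_eq (hO : IsOpen O) (hφ : ContDiffOn ℝ ∞ φ O)
    (hp : ∀ z : E n, z ≠ 0 → invariants a x z ∈ O) (hy : y ≠ 0)
    (hg : (fundamental (metric φ a) x y).PosDef)
    (hρ : rho φ (‖a‖ ^ 2) (invariants a x y) ≠ 0 ∨ ∀ i, perp x y i = 0 ∧ perp a y i = 0)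
    (i : Fin n) :
    spray (metric φ a) i x y =
      ‖y‖ * P φ (‖a‖ ^ 2) (invariants a x y) * y i
        + ‖y‖ * (‖y‖ * Q φ (‖a‖ ^ 2) (invariants a x y)) * x i
        + ‖y‖ * (‖y‖ * R φ (‖a‖ ^ 2) (invariants a x y)) * a i := by
  have hφ0 := phi_ne_zero hO hφ hp hy hg
  have h : ∀ l, ∑ j, fundamental (metric φ a) x y l j *
      (4 * ‖y‖ ^ 2 * Q φ (‖a‖ ^ 2) (invariants a x y) * perp x y j
        + 4 * ‖y‖ ^ 2 * R φ (‖a‖ ^ 2) (invariants a x y) * perp a y j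
        + 4 * ‖y‖ ^ 2 * (P φ (‖a‖ ^ 2) (invariants a x y)
          + invariants a x y 1 * Q φ (‖a‖ ^ 2) (invariants a x y)
          + invariants a x y 3 * R φ (‖a‖ ^ 2) (invariants a x y)) * ell y j)
      = (∑ k, dy l (dx k fun x y => metric φ a x y ^ 2) x y * y k)
        - dx l (fun x y => metric φ a x y ^ 2) x y := by
    intro l
    rw [sum_fundamental_mul hO hφ hp hy, spray_numerator hO hφ hp hy]
    have hP : φ (invariants a x y) * (P φ (‖a‖ ^ 2) (invariants a x y)
          + invariants a x y 1 * Q φ (‖a‖ ^ 2) (invariants a x y)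
          + invariants a x y 3 * R φ (‖a‖ ^ 2) (invariants a x y))
        + ds φ (invariants a x y) * (us (invariants a x y) * Q φ (‖a‖ ^ 2) (invariants a x y)
          + vst (invariants a x y) * R φ (‖a‖ ^ 2) (invariants a x y))
        + dt φ (invariants a x y) * (vst (invariants a x y) * Q φ (‖a‖ ^ 2) (invariants a x y)
          + at2 (‖a‖ ^ 2) (invariants a x y) * R φ (‖a‖ ^ 2) (invariants a x y))
        = (2 * invariants a x y 1 * du φ (invariants a x y) + ds φ (invariants a x y)
            + invariants a x y 3 * dv φ (invariants a x y)) / 2 := by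
      simp only [P]
      generalize Q φ (‖a‖ ^ 2) (invariants a x y) = q'
      generalize R φ (‖a‖ ^ 2) (invariants a x y) = r'
      field_simp
      ring
    rcases hρ with hρ | h0
    · have hQ : sigma1 φ (invariants a x y) * Q φ (‖a‖ ^ 2) (invariants a x y)
          + ds (ds φ) (invariants a x y)
            * (us (invariants a x y) * Q φ (‖a‖ ^ 2) (invariants a x y)
              + vst (invariants a x y) * R φ (‖a‖ ^ 2) (invariants a x y))
          + dt (ds φ) (invariants a x y)
            * (vst (invariants a x y) * Q φ (‖a‖ ^ 2) (invariants a x y)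
              + at2 (‖a‖ ^ 2) (invariants a x y) * R φ (‖a‖ ^ 2) (invariants a x y))
          = lam φ (invariants a x y) / 2 := by
        simp only [Q, R]
        field_simp
        simp only [rho, hess]
        ring
      have hR : sigma1 φ (invariants a x y) * R φ (‖a‖ ^ 2) (invariants a x y)
          + dt (ds φ) (invariants a x y)
            * (us (invariants a x y) * Q φ (‖a‖ ^ 2) (invariants a x y)
              + vst (invariants a x y) * R φ (‖a‖ ^ 2) (invariants a x y))
          + dt (dt φ) (invariants a x y)
            * (vst (invariants a x y) * Q φ (‖a‖ ^ 2) (invariants a x y)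
              + at2 (‖a‖ ^ 2) (invariants a x y) * R φ (‖a‖ ^ 2) (invariants a x y))
          = mu φ (invariants a x y) / 2 := by
        simp only [Q, R]
        field_simp
        simp only [rho, hess]
        ring
      linear_combination 4 * ‖y‖ ^ 2 * radialD1 φ a x y l * hP
        + 4 * ‖y‖ ^ 2 * φ (invariants a x y) * perp x y l * hQ
        + 4 * ‖y‖ ^ 2 * φ (invariants a x y) * perp a y l * hR
    · rw [(h0 l).1, (h0 l).2]
      linear_combination 4 * ‖y‖ ^ 2 * radialD1 φ a x y l * hP
  simp only [spray]
  rw [sum_inv_mul_of_sum_mul hg h, ← norm_mul_ell hy i]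
  simp only [perp, invariants, Matrix.cons_val]
  ring

end

/-! ### Smoothness of the spray coefficients and of the mean Landsberg components -/

/-- `φ` is smooth on the open set `O`, the functions by which the coefficients of the spray and of
the mean Landsberg curvature are divided do not vanish on `O`, the invariants of `U` lie in `O`,
and the fundamental tensor is positive definite. -/
structure RegularOn (φ : (Fin 4 → ℝ) → ℝ) (a : E n) (U : Set (E n)) (O : Set (Fin 4 → ℝ)) :
    Prop where
  isOpen : IsOpen O
  smooth : ContDiffOn ℝ ∞ φ O
  phi_ne : ∀ p ∈ O, φ p ≠ 0
  c0_ne : ∀ p ∈ O, c0 φ p ≠ 0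
  rho_ne : ∀ p ∈ O, rho φ (‖a‖ ^ 2) p ≠ 0
  mem : ∀ x ∈ U, ∀ y : E n, y ≠ 0 → invariants a x y ∈ O
  posDef : ∀ x ∈ U, ∀ y : E n, y ≠ 0 → (fundamental (metric φ a) x y).PosDef

section Smooth

variable {O : Set (Fin 4 → ℝ)} {φ : (Fin 4 → ℝ) → ℝ} (a2 : ℝ)

theorem contDiffOn_us : ContDiffOn ℝ ∞ us O := by
  unfold us
  exact (contDiffOn_coord 0).sub ((contDiffOn_coord 1).pow 2)

theorem contDiffOn_vst : ContDiffOn ℝ ∞ vst O := by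
  unfold vst
  exact (contDiffOn_coord 2).sub ((contDiffOn_coord 1).mul (contDiffOn_coord 3))

theorem contDiffOn_at2 : ContDiffOn ℝ ∞ (at2 a2) O := by
  unfold at2
  exact contDiffOn_const.sub ((contDiffOn_coord 3).pow 2)

theorem contDiffOn_sigma1 (hO : IsOpen O) (hφ : ContDiffOn ℝ ∞ φ O) :
    ContDiffOn ℝ ∞ (sigma1 φ) O := by
  unfold sigma1
  have := contDiffOn_ds hO hφ
  have := contDiffOn_dt hO hφ
  have := fun i => contDiffOn_coord (O := O) i
  fun_prop

theorem contDiffOn_c0 (hO : IsOpen O) (hφ : ContDiffOn ℝ ∞ φ O) :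
    ContDiffOn ℝ ∞ (c0 φ) O := by
  unfold c0
  have := contDiffOn_ds hO hφ
  have := contDiffOn_dt hO hφ
  have := fun i => contDiffOn_coord (O := O) i
  fun_prop

theorem contDiffOn_hess (hO : IsOpen O) (hφ : ContDiffOn ℝ ∞ φ O) :
    ContDiffOn ℝ ∞ (hess φ) O := by
  unfold hess
  have := contDiffOn_ds hO (contDiffOn_ds hO hφ)
  have := contDiffOn_dt hO (contDiffOn_ds hO hφ)
  have := contDiffOn_dt hO (contDiffOn_dt hO hφ)
  fun_prop

theorem contDiffOn_rho (hO : IsOpen O) (hφ : ContDiffOn ℝ ∞ φ O) :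
    ContDiffOn ℝ ∞ (rho φ a2) O := by
  unfold rho
  have := contDiffOn_ds hO (contDiffOn_ds hO hφ)
  have := contDiffOn_dt hO (contDiffOn_ds hO hφ)
  have := contDiffOn_dt hO (contDiffOn_dt hO hφ)
  have := contDiffOn_sigma1 hO hφ
  have := contDiffOn_hess hO hφ
  have := contDiffOn_us (O := O)
  have := contDiffOn_vst (O := O)
  have := contDiffOn_at2 (O := O) a2
  fun_prop

theorem contDiffOn_lam (hO : IsOpen O) (hφ : ContDiffOn ℝ ∞ φ O) :
    ContDiffOn ℝ ∞ (lam φ) O := by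
  unfold lam
  have := contDiffOn_du hO hφ
  have := contDiffOn_ds hO (contDiffOn_du hO hφ)
  have := contDiffOn_ds hO (contDiffOn_ds hO hφ)
  have := contDiffOn_dv hO (contDiffOn_ds hO hφ)
  have := fun i => contDiffOn_coord (O := O) i
  fun_prop

theorem contDiffOn_mu (hO : IsOpen O) (hφ : ContDiffOn ℝ ∞ φ O) :
    ContDiffOn ℝ ∞ (mu φ) O := by
  unfold mu
  have := contDiffOn_dv hO hφ
  have := contDiffOn_dt hO (contDiffOn_du hO hφ)
  have := contDiffOn_dt hO (contDiffOn_ds hO hφ)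
  have := contDiffOn_dt hO (contDiffOn_dv hO hφ)
  have := fun i => contDiffOn_coord (O := O) i
  fun_prop

variable {a2}

theorem contDiffOn_Q (hO : IsOpen O) (hφ : ContDiffOn ℝ ∞ φ O) (hρ : ∀ p ∈ O, rho φ a2 p ≠ 0) :
    ContDiffOn ℝ ∞ (Q φ a2) O := by
  unfold Q
  refine ContDiffOn.div ?_ (contDiffOn_const.mul (contDiffOn_rho a2 hO hφ))
    fun p hp => mul_ne_zero two_ne_zero (hρ p hp)
  have := contDiffOn_ds hO (contDiffOn_ds hO hφ)
  have := contDiffOn_dt hO (contDiffOn_ds hO hφ)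
  have := contDiffOn_dt hO (contDiffOn_dt hO hφ)
  have := contDiffOn_sigma1 hO hφ
  have := contDiffOn_lam hO hφ
  have := contDiffOn_mu hO hφ
  have := contDiffOn_vst (O := O)
  have := contDiffOn_at2 (O := O) a2
  fun_prop

theorem contDiffOn_R (hO : IsOpen O) (hφ : ContDiffOn ℝ ∞ φ O) (hρ : ∀ p ∈ O, rho φ a2 p ≠ 0) :
    ContDiffOn ℝ ∞ (R φ a2) O := by
  unfold R
  refine ContDiffOn.div ?_ (contDiffOn_const.mul (contDiffOn_rho a2 hO hφ))
    fun p hp => mul_ne_zero two_ne_zero (hρ p hp)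
  have := contDiffOn_ds hO (contDiffOn_ds hO hφ)
  have := contDiffOn_dt hO (contDiffOn_ds hO hφ)
  have := contDiffOn_dt hO (contDiffOn_dt hO hφ)
  have := contDiffOn_sigma1 hO hφ
  have := contDiffOn_lam hO hφ
  have := contDiffOn_mu hO hφ
  have := contDiffOn_us (O := O)
  have := contDiffOn_vst (O := O)
  fun_prop

theorem contDiffOn_P (hO : IsOpen O) (hφ : ContDiffOn ℝ ∞ φ O) (hφ0 : ∀ p ∈ O, φ p ≠ 0)
    (hρ : ∀ p ∈ O, rho φ a2 p ≠ 0) : ContDiffOn ℝ ∞ (P φ a2) O := by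
  unfold P
  have := contDiffOn_du hO hφ
  have := contDiffOn_ds hO hφ
  have := contDiffOn_dv hO hφ
  have := contDiffOn_dt hO hφ
  have := contDiffOn_Q hO hφ hρ
  have := contDiffOn_R hO hφ hρ
  have := contDiffOn_us (O := O)
  have := contDiffOn_vst (O := O)
  have := contDiffOn_at2 (O := O) a2
  have := fun i => contDiffOn_coord (O := O) i
  refine ContDiffOn.sub (.sub (.sub (.div ?_ ?_ fun p hp => mul_ne_zero two_ne_zero (hφ0 p hp))
    ?_) ?_) (.div ?_ hφ hφ0) <;> fun_prop

theorem contDiffOn_third_order (hO : IsOpen O) {f : (Fin 4 → ℝ) → ℝ} (hf : ContDiffOn ℝ ∞ f O) :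
    (ContDiffOn ℝ ∞ (ds f) O ∧ ContDiffOn ℝ ∞ (dt f) O) ∧
    (ContDiffOn ℝ ∞ (ds (ds f)) O ∧ ContDiffOn ℝ ∞ (dt (ds f)) O ∧
      ContDiffOn ℝ ∞ (dt (dt f)) O) ∧
    (ContDiffOn ℝ ∞ (ds (ds (ds f))) O ∧ ContDiffOn ℝ ∞ (dt (ds (ds f))) O ∧
      ContDiffOn ℝ ∞ (dt (dt (ds f))) O ∧ ContDiffOn ℝ ∞ (dt (dt (dt f))) O) := by
  have hs := contDiffOn_ds hO hf
  have ht := contDiffOn_dt hO hf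
  have hss := contDiffOn_ds hO hs
  have hst := contDiffOn_dt hO hs
  have htt := contDiffOn_dt hO ht
  exact ⟨⟨hs, ht⟩, ⟨hss, hst, htt⟩, contDiffOn_ds hO hss, contDiffOn_dt hO hss,
    contDiffOn_dt hO hst, contDiffOn_dt hO htt⟩

theorem contDiffOn_inv_metric_coeffs (hO : IsOpen O) (hφ : ContDiffOn ℝ ∞ φ O)
    (hρ : ∀ p ∈ O, rho φ a2 p ≠ 0) :
    ContDiffOn ℝ ∞ (A φ a2) O ∧ ContDiffOn ℝ ∞ (B φ a2) O ∧ ContDiffOn ℝ ∞ (C φ a2) O := by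
  have := contDiffOn_ds hO (contDiffOn_ds hO hφ)
  have := contDiffOn_dt hO (contDiffOn_ds hO hφ)
  have := contDiffOn_dt hO (contDiffOn_dt hO hφ)
  have := contDiffOn_sigma1 hO hφ
  have := contDiffOn_hess hO hφ
  have := contDiffOn_us (O := O)
  have := contDiffOn_vst (O := O)
  have := contDiffOn_at2 (O := O) a2
  have hr := contDiffOn_rho a2 hO hφ
  unfold A B C
  refine ⟨.div ?_ hr hρ, .div ?_ hr hρ, .div ?_ hr hρ⟩ <;> fun_prop

theorem contDiffOn_landsberg_coeffs (hO : IsOpen O) (hφ : ContDiffOn ℝ ∞ φ O)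
    (hφ0 : ∀ p ∈ O, φ p ≠ 0) (hρ : ∀ p ∈ O, rho φ a2 p ≠ 0) :
    ContDiffOn ℝ ∞ (L1 φ a2) O ∧ ContDiffOn ℝ ∞ (L2 φ a2) O ∧ ContDiffOn ℝ ∞ (L3 φ a2) O ∧
    ContDiffOn ℝ ∞ (L4 φ a2) O ∧ ContDiffOn ℝ ∞ (L5 φ a2) O ∧ ContDiffOn ℝ ∞ (L6 φ a2) O := by
  have hP := contDiffOn_P hO hφ hφ0 hρ
  have hQ := contDiffOn_Q hO hφ hρ
  have hR := contDiffOn_R hO hφ hρ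
  obtain ⟨⟨_, _⟩, ⟨_, _, _⟩, _, _, _, _⟩ := contDiffOn_third_order hO hP
  obtain ⟨⟨_, _⟩, ⟨_, _, _⟩, _, _, _, _⟩ := contDiffOn_third_order hO hQ
  obtain ⟨⟨_, _⟩, ⟨_, _, _⟩, _, _, _, _⟩ := contDiffOn_third_order hO hR
  have := contDiffOn_ds hO hφ
  have := contDiffOn_dt hO hφ
  have := contDiffOn_us (O := O)
  have := contDiffOn_vst (O := O)
  have := contDiffOn_at2 (O := O) a2
  have := fun i => contDiffOn_coord (O := O) i
  unfold L1 L2 L3 L4 L5 L6 ex ea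
  refine ⟨?_, ?_, ?_, ?_, ?_, ?_⟩ <;> fun_prop

theorem contDiffOn_K_H (n : ℕ) (hO : IsOpen O) (hφ : ContDiffOn ℝ ∞ φ O)
    (hφ0 : ∀ p ∈ O, φ p ≠ 0) (hc0 : ∀ p ∈ O, c0 φ p ≠ 0) (hρ : ∀ p ∈ O, rho φ a2 p ≠ 0) :
    ContDiffOn ℝ ∞ (K n φ a2) O ∧ ContDiffOn ℝ ∞ (H n φ a2) O := by
  obtain ⟨_, _, _, _, _, _⟩ := contDiffOn_landsberg_coeffs hO hφ hφ0 hρ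
  obtain ⟨_, _, _⟩ := contDiffOn_inv_metric_coeffs hO hφ hρ
  have := contDiffOn_us (O := O)
  have := contDiffOn_vst (O := O)
  have := contDiffOn_at2 (O := O) a2
  have hd : ContDiffOn ℝ ∞ (fun p => φ p / (2 * c0 φ p)) O :=
    hφ.div (contDiffOn_const.mul (contDiffOn_c0 hO hφ))
      fun p hp => mul_ne_zero two_ne_zero (hc0 p hp)
  unfold K H phi0 phi1 phi2 phi3 phi4 phi5 phi6
  refine ⟨hd.mul ?_, hd.mul ?_⟩ <;> fun_prop

end Smooth

/-! ### The Landsberg curvature -/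

namespace RegularOn

variable {O : Set (Fin 4 → ℝ)} {φ : (Fin 4 → ℝ) → ℝ} {a x y : E n} {U : Set (E n)}

theorem contDiffOn_P (h : RegularOn φ a U O) : ContDiffOn ℝ ∞ (P φ (‖a‖ ^ 2)) O :=
  GSS.contDiffOn_P h.isOpen h.smooth h.phi_ne h.rho_ne

theorem contDiffOn_Q (h : RegularOn φ a U O) : ContDiffOn ℝ ∞ (Q φ (‖a‖ ^ 2)) O :=
  GSS.contDiffOn_Q h.isOpen h.smooth h.rho_ne

theorem contDiffOn_R (h : RegularOn φ a U O) : ContDiffOn ℝ ∞ (R φ (‖a‖ ^ 2)) O :=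
  GSS.contDiffOn_R h.isOpen h.smooth h.rho_ne

theorem spray_eq (h : RegularOn φ a U O) (hx : x ∈ U) (hy : y ≠ 0) (l : Fin n) :
    spray (metric φ a) l x y =
      ‖y‖ * P φ (‖a‖ ^ 2) (invariants a x y) * y l
        + ‖y‖ * (‖y‖ * Q φ (‖a‖ ^ 2) (invariants a x y)) * x l
        + ‖y‖ * (‖y‖ * R φ (‖a‖ ^ 2) (invariants a x y)) * a l :=
  GSS.spray_eq h.isOpen h.smooth (h.mem x hx) hy (h.posDef x hx y hy)
    (.inl (h.rho_ne _ (h.mem x hx y hy))) l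

theorem dy_spray (h : RegularOn φ a U O) (hx : x ∈ U) (hy : y ≠ 0) (k l : Fin n) :
    dy k (spray (metric φ a) l) x y =
      radialD1 (P φ (‖a‖ ^ 2)) a x y k * y l
        + ‖y‖ * P φ (‖a‖ ^ 2) (invariants a x y) * delta k l
        + radialSqD1 (Q φ (‖a‖ ^ 2)) a x y k * x l
        + radialSqD1 (R φ (‖a‖ ^ 2)) a x y k * a l := by
  have hd : ∀ {g}, ContDiffOn ℝ ∞ g O → DifferentiableAt ℝ g (invariants a x y) := fun hg =>
    differentiableAt_of_contDiffOn h.isOpen hg (h.mem x hx y hy)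
  refine dy_eq_of_hasDirDeriv hy (f₀ := fun x y =>
    ‖y‖ * P φ (‖a‖ ^ 2) (invariants a x y) * y l
        + ‖y‖ * (‖y‖ * Q φ (‖a‖ ^ 2) (invariants a x y)) * x l
        + ‖y‖ * (‖y‖ * R φ (‖a‖ ^ 2) (invariants a x y)) * a l)
    (fun z hz => h.spray_eq hx hz l) ((((((hasDirDeriv_radial hy (hd h.contDiffOn_P) k).mul
      (hasDirDeriv_coord k l y)).add ((hasDirDeriv_radialSq hy (hd h.contDiffOn_Q) k).mul
      (.const (x l)))).add ((hasDirDeriv_radialSq hy (hd h.contDiffOn_R) k).mul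
      (.const (a l))))).congr_deriv ?_)
  ring

theorem dy_dy_spray (h : RegularOn φ a U O) (hx : x ∈ U) (hy : y ≠ 0) (j k l : Fin n) :
    dy j (dy k (spray (metric φ a) l)) x y =
      radialD2 (P φ (‖a‖ ^ 2)) a x y j k * y l
        + radialD1 (P φ (‖a‖ ^ 2)) a x y k * delta j l
        + radialD1 (P φ (‖a‖ ^ 2)) a x y j * delta k l
        + radialSqD2 (Q φ (‖a‖ ^ 2)) a x y j k * x l
        + radialSqD2 (R φ (‖a‖ ^ 2)) a x y j k * a l := by
  have hp := h.mem x hx y hy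
  refine dy_eq_of_hasDirDeriv hy (f₀ := fun x y =>
      radialD1 (P φ (‖a‖ ^ 2)) a x y k * y l
        + ‖y‖ * P φ (‖a‖ ^ 2) (invariants a x y) * delta k l
        + radialSqD1 (Q φ (‖a‖ ^ 2)) a x y k * x l
        + radialSqD1 (R φ (‖a‖ ^ 2)) a x y k * a l)
    (fun z hz => h.dy_spray hx hz k l)
    ((((((hasDirDeriv_radialD1 h.isOpen h.contDiffOn_P hp hy j k).mul
      (hasDirDeriv_coord j l y)).add ((hasDirDeriv_radial hy (differentiableAt_of_contDiffOn
      h.isOpen h.contDiffOn_P hp) j).mul (.const (delta k l)))).add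
      ((hasDirDeriv_radialSqD1 h.isOpen h.contDiffOn_Q hp hy j k).mul (.const (x l)))).add
      ((hasDirDeriv_radialSqD1 h.isOpen h.contDiffOn_R hp hy j k).mul
      (.const (a l)))).congr_deriv ?_)
  ring

theorem dy_dy_dy_spray (h : RegularOn φ a U O) (hx : x ∈ U) (hy : y ≠ 0) (i j k l : Fin n) :
    dy i (dy j (dy k (spray (metric φ a) l))) x y =
      radialD3 (P φ (‖a‖ ^ 2)) a x y i j k * y l
        + radialD2 (P φ (‖a‖ ^ 2)) a x y j k * delta i l
        + radialD2 (P φ (‖a‖ ^ 2)) a x y i k * delta j l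
        + radialD2 (P φ (‖a‖ ^ 2)) a x y i j * delta k l
        + radialSqD3 (Q φ (‖a‖ ^ 2)) a x y i j k * x l
        + radialSqD3 (R φ (‖a‖ ^ 2)) a x y i j k * a l := by
  have hp := h.mem x hx y hy
  refine dy_eq_of_hasDirDeriv hy (f₀ := fun x y =>
      radialD2 (P φ (‖a‖ ^ 2)) a x y j k * y l
        + radialD1 (P φ (‖a‖ ^ 2)) a x y k * delta j l
        + radialD1 (P φ (‖a‖ ^ 2)) a x y j * delta k l
        + radialSqD2 (Q φ (‖a‖ ^ 2)) a x y j k * x l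
        + radialSqD2 (R φ (‖a‖ ^ 2)) a x y j k * a l)
    (fun z hz => h.dy_dy_spray hx hz j k l)
    (((((((hasDirDeriv_radialD2 h.isOpen h.contDiffOn_P hp hy i j k).mul
      (hasDirDeriv_coord i l y)).add ((hasDirDeriv_radialD1 h.isOpen h.contDiffOn_P hp hy i k).mul
      (.const (delta j l)))).add ((hasDirDeriv_radialD1 h.isOpen h.contDiffOn_P hp hy i j).mul
      (.const (delta k l)))).add
      ((hasDirDeriv_radialSqD2 h.isOpen h.contDiffOn_Q hp hy i j k).mul (.const (x l)))).add
      ((hasDirDeriv_radialSqD2 h.isOpen h.contDiffOn_R hp hy i j k).mul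
      (.const (a l)))).congr_deriv ?_)
  ring

end RegularOn

/-! ### Contractions with F_y and the Landsberg tensor -/

theorem sum_radialD1_mul (f : (Fin 4 → ℝ) → ℝ) (a x y z : E n) :
    ∑ l, radialD1 f a x y l * z l
      = f (invariants a x y) * (inner ℝ z y / ‖y‖)
        + ds f (invariants a x y) * (inner ℝ x z - inner ℝ x y / ‖y‖ * (inner ℝ z y / ‖y‖))
        + dt f (invariants a x y) * (inner ℝ a z - inner ℝ a y / ‖y‖ * (inner ℝ z y / ‖y‖)) := by
  have h := sum_mul_linear_comb_three (f (invariants a x y)) (ds f (invariants a x y))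
    (dt f (invariants a x y)) (ell y) (perp x y) (perp a y) (fun l => z l)
  simp only [mul_comm (z _)] at h
  simp only [radialD1, h, sum_ell_mul, sum_perp_mul]

/-- Euler's relation for the 1-homogeneous function r f. -/
theorem sum_radialD1_mul_y (f : (Fin 4 → ℝ) → ℝ) (a x : E n) {y : E n} (hy : y ≠ 0) :
    ∑ l, radialD1 f a x y l * y l = ‖y‖ * f (invariants a x y) := by
  have h0 : ‖y‖ ≠ 0 := norm_ne_zero_iff.2 hy
  rw [sum_radialD1_mul, real_inner_self_eq_norm_sq]
  field_simp
  ring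

theorem sum_radialD1_mul_x (φ : (Fin 4 → ℝ) → ℝ) (a x y : E n) :
    ∑ l, radialD1 φ a x y l * x l = ex φ (invariants a x y) := by
  rw [sum_radialD1_mul]
  simp only [ex, us, vst, invariants, Matrix.cons_val, real_inner_self_eq_norm_sq]
  ring

theorem sum_radialD1_mul_a (φ : (Fin 4 → ℝ) → ℝ) (a x y : E n) :
    ∑ l, radialD1 φ a x y l * a l = ea φ (‖a‖ ^ 2) (invariants a x y) := by
  rw [sum_radialD1_mul, real_inner_comm a x]
  simp only [ea, at2, vst, invariants, Matrix.cons_val, real_inner_self_eq_norm_sq]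
  ring

theorem sum_mul_linear_comb_six {ι : Type*} [Fintype ι] (c₁ c₂ c₃ c₄ c₅ c₆ : ℝ)
    (t₁ t₂ t₃ t₄ t₅ t₆ z : ι → ℝ) :
    ∑ j, z j * (c₁ * t₁ j + c₂ * t₂ j + c₃ * t₃ j + c₄ * t₄ j + c₅ * t₅ j + c₆ * t₆ j)
      = c₁ * ∑ j, z j * t₁ j + c₂ * ∑ j, z j * t₂ j + c₃ * ∑ j, z j * t₃ j
        + c₄ * ∑ j, z j * t₄ j + c₅ * ∑ j, z j * t₅ j + c₆ * ∑ j, z j * t₆ j := by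
  simp only [Finset.mul_sum, ← Finset.sum_add_distrib]
  exact Finset.sum_congr rfl fun j _ => by ring

theorem sum_mul_delta (i : Fin n) (f : Fin n → ℝ) : ∑ l, f l * delta i l = f i := by
  simp [delta]

/-- Contracting G^l_{ijk} with F_{y^l} replaces y, x, a by F, `ex`, `ea` and each δ by a component
of F_y. The ℓ-terms of `radialD3` cancel against the ℓ-parts of F_y, so only ξ, η and m occur. -/
theorem RegularOn.landsberg_eq {O : Set (Fin 4 → ℝ)} {φ : (Fin 4 → ℝ) → ℝ} {a x y : E n}
    {U : Set (E n)} (h : RegularOn φ a U O) (hx : x ∈ U) (hy : y ≠ 0) (i j k : Fin n) :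
    landsberg (metric φ a) i j k x y = -(φ (invariants a x y) / 2)
      * (L1 φ (‖a‖ ^ 2) (invariants a x y) * (perp x y i * perp x y j * perp x y k)
        + L2 φ (‖a‖ ^ 2) (invariants a x y)
          * (ang y i j * perp x y k + ang y i k * perp x y j + ang y j k * perp x y i)
        + L3 φ (‖a‖ ^ 2) (invariants a x y) * (perp a y i * perp a y j * perp a y k)
        + L4 φ (‖a‖ ^ 2) (invariants a x y)
          * (ang y i j * perp a y k + ang y i k * perp a y j + ang y j k * perp a y i)
        + L5 φ (‖a‖ ^ 2) (invariants a x y) * (perp x y i * perp x y j * perp a y k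
          + perp x y i * perp a y j * perp x y k + perp a y i * perp x y j * perp x y k)
        + L6 φ (‖a‖ ^ 2) (invariants a x y) * (perp x y i * perp a y j * perp a y k
          + perp a y i * perp x y j * perp a y k + perp a y i * perp a y j * perp x y k)) := by
  have h0 : ‖y‖ ≠ 0 := norm_ne_zero_iff.2 hy
  simp only [landsberg, h.dy_dy_dy_spray hx hy, dy_metric h.isOpen h.smooth (h.mem x hx y hy) hy,
    sum_mul_linear_comb_six, sum_mul_delta, sum_radialD1_mul_y _ _ _ hy, sum_radialD1_mul_x,
    sum_radialD1_mul_a]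
  simp only [metric, radialD3, radialSqD3, radialD1, radialD2, sigma1, L1, L2, L3, L4, L5, L6]
  generalize perp x y = X
  generalize perp a y = A
  generalize ang y = m
  field_simp
  ring

/-! ### The mean Landsberg curvature -/

theorem sum_sum_mul_linear_comb_six {ι : Type*} [Fintype ι] (c₁ c₂ c₃ c₄ c₅ c₆ : ℝ)
    (t₁ t₂ t₃ t₄ t₅ t₆ : ι → ι → ℝ) (z : Matrix ι ι ℝ) :
    ∑ j, ∑ k, z j k * (c₁ * t₁ j k + c₂ * t₂ j k + c₃ * t₃ j k + c₄ * t₄ j k + c₅ * t₅ j k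
        + c₆ * t₆ j k)
      = c₁ * ∑ j, ∑ k, z j k * t₁ j k + c₂ * ∑ j, ∑ k, z j k * t₂ j k
        + c₃ * ∑ j, ∑ k, z j k * t₃ j k + c₄ * ∑ j, ∑ k, z j k * t₄ j k
        + c₅ * ∑ j, ∑ k, z j k * t₅ j k + c₆ * ∑ j, ∑ k, z j k * t₆ j k := by
  simp only [sum_mul_linear_comb_six, Finset.mul_sum, ← Finset.sum_add_distrib]

section Contraction

variable {G : Matrix (Fin n) (Fin n) ℝ} {v v' : Fin n → ℝ}

theorem sum_sum_mul_mul (hv : ∀ j, ∑ k, G j k * v k = v' j) (u : Fin n → ℝ) :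
    ∑ j, ∑ k, G j k * (u j * v k) = ∑ j, u j * v' j := by
  refine Finset.sum_congr rfl fun j _ => ?_
  rw [← hv j, Finset.mul_sum]
  exact Finset.sum_congr rfl fun k _ => by ring

theorem sum_sum_mul_symm_mul (hG : ∀ j k, G j k = G k j) (hv : ∀ j, ∑ k, G j k * v k = v' j)
    (u : Fin n → ℝ) :
    ∑ j, ∑ k, G j k * (u j * v k + u k * v j) = 2 * ∑ j, u j * v' j := by
  have h : ∑ j, ∑ k, G j k * (u k * v j) = ∑ j, u j * v' j := by
    rw [Finset.sum_comm, ← sum_sum_mul_mul hv u]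
    simp only [fun j k => hG k j]
  simp only [mul_add, Finset.sum_add_distrib]
  rw [h, sum_sum_mul_mul hv u]
  ring

end Contraction

namespace RegularOn

variable {O : Set (Fin 4 → ℝ)} {φ : (Fin 4 → ℝ) → ℝ} {a x y : E n} {U : Set (E n)}

/-- The solution `z` of `g z = b` for `b = α₀ (x - s ℓ) + β₀ (a - t ℓ)`, modulo `y`. -/
theorem exists_sum_inv_fundamental_mul (h : RegularOn φ a U O) (hx : x ∈ U) (hy : y ≠ 0)
    {α β α₀ β₀ : ℝ}
    (h1 : φ (invariants a x y)
      * (sigma1 φ (invariants a x y) * α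
        + ds (ds φ) (invariants a x y)
          * (us (invariants a x y) * α + vst (invariants a x y) * β)
        + dt (ds φ) (invariants a x y)
          * (vst (invariants a x y) * α + at2 (‖a‖ ^ 2) (invariants a x y) * β)) = α₀)
    (h2 : φ (invariants a x y)
      * (sigma1 φ (invariants a x y) * β
        + dt (ds φ) (invariants a x y)
          * (us (invariants a x y) * α + vst (invariants a x y) * β)
        + dt (dt φ) (invariants a x y)
          * (vst (invariants a x y) * α + at2 (‖a‖ ^ 2) (invariants a x y) * β)) = β₀) :
    ∃ κ : ℝ, ∀ j, ∑ k, (fundamental (metric φ a) x y)⁻¹ j k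
        * (α₀ * perp x y k + β₀ * perp a y k)
      = α * perp x y j + β * perp a y j + κ * ell y j := by
  have hφ0 := h.phi_ne _ (h.mem x hx y hy)
  refine ⟨-(ds φ (invariants a x y) * (us (invariants a x y) * α + vst (invariants a x y) * β)
        + dt φ (invariants a x y)
          * (vst (invariants a x y) * α + at2 (‖a‖ ^ 2) (invariants a x y) * β))
        / φ (invariants a x y), sum_inv_mul_of_sum_mul (h.posDef x hx y hy) fun i => ?_⟩
  rw [sum_fundamental_mul h.isOpen h.smooth (h.mem x hx) hy, h1, h2]
  field_simp
  ring

/-- The coefficients are those of (m - Aξ⊗ξ - B(ξ⊗η + η⊗ξ) - Cη⊗η)/c₀ applied to ξ. The ℓ-component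
κ is left unspecified because all later contractions are with ξ, η or m, which annihilate ℓ. -/
theorem exists_sum_inv_fundamental_mul_perp_x (h : RegularOn φ a U O) (hx : x ∈ U) (hy : y ≠ 0) :
    ∃ κ : ℝ, ∀ j, ∑ k, (fundamental (metric φ a) x y)⁻¹ j k * perp x y k
      = (1 - A φ (‖a‖ ^ 2) (invariants a x y) * us (invariants a x y)
          - B φ (‖a‖ ^ 2) (invariants a x y) * vst (invariants a x y)) / c0 φ (invariants a x y)
          * perp x y j
        + -(B φ (‖a‖ ^ 2) (invariants a x y) * us (invariants a x y)
          + C φ (‖a‖ ^ 2) (invariants a x y) * vst (invariants a x y)) / c0 φ (invariants a x y)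
          * perp a y j
        + κ * ell y j := by
  have hρ := h.rho_ne _ (h.mem x hx y hy)
  have hφ0 := h.phi_ne _ (h.mem x hx y hy)
  have hc := h.c0_ne _ (h.mem x hx y hy)
  have hcσ : c0 φ (invariants a x y) = φ (invariants a x y) * sigma1 φ (invariants a x y) := by
    simp only [c0, sigma1]; ring
  have hσ : sigma1 φ (invariants a x y) ≠ 0 := right_ne_zero_of_mul (hcσ ▸ hc)
  obtain ⟨κ, hκ⟩ := h.exists_sum_inv_fundamental_mul hx hy (α₀ := 1) (β₀ := 0)
    (α := (1 - A φ (‖a‖ ^ 2) (invariants a x y) * us (invariants a x y)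
          - B φ (‖a‖ ^ 2) (invariants a x y) * vst (invariants a x y)) / c0 φ (invariants a x y))
    (β := -(B φ (‖a‖ ^ 2) (invariants a x y) * us (invariants a x y)
          + C φ (‖a‖ ^ 2) (invariants a x y) * vst (invariants a x y)) / c0 φ (invariants a x y))
    (by
      rw [hcσ]
      simp only [A, B, C]
      field_simp
      simp only [rho, hess]
      ring)
    (by
      rw [hcσ]
      simp only [A, B, C]
      field_simp
      simp only [rho, hess]
      ring)
  exact ⟨κ, by simpa using hκ⟩

theorem exists_sum_inv_fundamental_mul_perp_a (h : RegularOn φ a U O) (hx : x ∈ U) (hy : y ≠ 0) :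
    ∃ κ : ℝ, ∀ j, ∑ k, (fundamental (metric φ a) x y)⁻¹ j k * perp a y k
      = -(A φ (‖a‖ ^ 2) (invariants a x y) * vst (invariants a x y)
          + B φ (‖a‖ ^ 2) (invariants a x y) * at2 (‖a‖ ^ 2) (invariants a x y))
          / c0 φ (invariants a x y) * perp x y j
        + (1 - B φ (‖a‖ ^ 2) (invariants a x y) * vst (invariants a x y)
          - C φ (‖a‖ ^ 2) (invariants a x y) * at2 (‖a‖ ^ 2) (invariants a x y))
          / c0 φ (invariants a x y) * perp a y j
        + κ * ell y j := by
  have hρ := h.rho_ne _ (h.mem x hx y hy)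
  have hφ0 := h.phi_ne _ (h.mem x hx y hy)
  have hc := h.c0_ne _ (h.mem x hx y hy)
  have hcσ : c0 φ (invariants a x y) = φ (invariants a x y) * sigma1 φ (invariants a x y) := by
    simp only [c0, sigma1]; ring
  have hσ : sigma1 φ (invariants a x y) ≠ 0 := right_ne_zero_of_mul (hcσ ▸ hc)
  obtain ⟨κ, hκ⟩ := h.exists_sum_inv_fundamental_mul hx hy (α₀ := 0) (β₀ := 1)
    (α := -(A φ (‖a‖ ^ 2) (invariants a x y) * vst (invariants a x y)
          + B φ (‖a‖ ^ 2) (invariants a x y) * at2 (‖a‖ ^ 2) (invariants a x y))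
          / c0 φ (invariants a x y))
    (β := (1 - B φ (‖a‖ ^ 2) (invariants a x y) * vst (invariants a x y)
          - C φ (‖a‖ ^ 2) (invariants a x y) * at2 (‖a‖ ^ 2) (invariants a x y))
          / c0 φ (invariants a x y))
    (by
      rw [hcσ]
      simp only [A, B, C]
      field_simp
      simp only [rho, hess]
      ring)
    (by
      rw [hcσ]
      simp only [A, B, C]
      field_simp
      simp only [rho, hess]
      ring)
  exact ⟨κ, by simpa using hκ⟩

theorem sum_inv_fundamental_mul_radialD1 (h : RegularOn φ a U O) (hx : x ∈ U) (hy : y ≠ 0)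
    (j : Fin n) :
    ∑ k, (fundamental (metric φ a) x y)⁻¹ j k * radialD1 φ a x y k
      = (φ (invariants a x y))⁻¹ * ell y j := by
  have hφ0 := h.phi_ne _ (h.mem x hx y hy)
  refine sum_inv_mul_of_sum_mul (h.posDef x hx y hy)
    (z := fun j => (φ (invariants a x y))⁻¹ * ell y j) (fun i => ?_) j
  have := sum_fundamental_mul h.isOpen h.smooth (h.mem x hx) hy i 0 0 (φ (invariants a x y))⁻¹
  simpa [hφ0] using this

theorem sum_sum_inv_fundamental_mul_fundamental (h : RegularOn φ a U O) (hx : x ∈ U)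
    (hy : y ≠ 0) :
    ∑ j, ∑ k, (fundamental (metric φ a) x y)⁻¹ j k * fundamental (metric φ a) x y j k = n := by
  have hg := h.posDef x hx y hy
  have hinv := Matrix.nonsing_inv_mul _ ((Matrix.isUnit_iff_isUnit_det _).1 hg.isUnit)
  have hj : ∀ j, ∑ k, (fundamental (metric φ a) x y)⁻¹ j k * fundamental (metric φ a) x y j k
      = 1 := by
    intro j
    have := congrFun (congrFun hinv j) j
    rw [Matrix.mul_apply, Matrix.one_apply_eq] at this
    rw [← this]
    exact Finset.sum_congr rfl fun k _ => by
      rw [fundamental_comm h.isOpen h.smooth (h.mem x hx) hy]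
  simp [hj]

/-- For fixed i the Landsberg tensor combines six tensors in (j,k), so only their g⁻¹-contractions
are needed. The functions φ₀, φ₃, φ₄ are, up to the factor -1/c₀, the products of ξ and η under g⁻¹.
-/
theorem meanLandsberg_eq (h : RegularOn φ a U O) (hx : x ∈ U) (hy : y ≠ 0) (i : Fin n) :
    meanLandsberg (metric φ a) i x y =
      K n φ (‖a‖ ^ 2) (invariants a x y) * perp x y i
        + H n φ (‖a‖ ^ 2) (invariants a x y) * perp a y i := by
  have hG : ∀ j k, (fundamental (metric φ a) x y)⁻¹ j k = (fundamental (metric φ a) x y)⁻¹ k j :=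
    fun j k => by simpa using ((h.posDef x hx y hy).inv.isHermitian.apply k j)
  have hρ := h.rho_ne _ (h.mem x hx y hy)
  have hφ0 := h.phi_ne _ (h.mem x hx y hy)
  have hc := h.c0_ne _ (h.mem x hx y hy)
  have hcσ : c0 φ (invariants a x y) = φ (invariants a x y) * sigma1 φ (invariants a x y) := by
    simp only [c0, sigma1]; ring
  have hσ : sigma1 φ (invariants a x y) ≠ 0 := right_ne_zero_of_mul (hcσ ▸ hc)
  obtain ⟨κ, hX⟩ := h.exists_sum_inv_fundamental_mul_perp_x hx hy
  obtain ⟨κ', hA⟩ := h.exists_sum_inv_fundamental_mul_perp_a hx hy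
  have hcontr := fun (α β κ : ℝ) (u : Fin n → ℝ) =>
    sum_mul_linear_comb_three α β κ (perp x y) (perp a y) (ell y) u
  have hXX : ∑ j, ∑ k, (fundamental (metric φ a) x y)⁻¹ j k * (perp x y j * perp x y k)
      = -phi0 φ (‖a‖ ^ 2) (invariants a x y) / c0 φ (invariants a x y) := by
    rw [sum_sum_mul_mul hX, hcontr, sum_perp_x_mul_perp_x a x hy, sum_perp_x_mul_perp_a a x hy,
      sum_perp_mul_ell _ hy]
    simp only [phi0]
    ring
  have hXA : ∑ j, ∑ k, (fundamental (metric φ a) x y)⁻¹ j k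
        * (perp x y j * perp a y k + perp x y k * perp a y j)
      = -2 * phi3 φ (‖a‖ ^ 2) (invariants a x y) / c0 φ (invariants a x y) := by
    rw [sum_sum_mul_symm_mul hG hA, hcontr, sum_perp_x_mul_perp_x a x hy,
      sum_perp_x_mul_perp_a a x hy, sum_perp_mul_ell _ hy]
    simp only [phi3]
    ring
  have hAA : ∑ j, ∑ k, (fundamental (metric φ a) x y)⁻¹ j k * (perp a y j * perp a y k)
      = -phi4 φ (‖a‖ ^ 2) (invariants a x y) / c0 φ (invariants a x y) := by
    rw [sum_sum_mul_mul hA, hcontr, sum_perp_a_mul_perp_a a x hy, sum_perp_a_mul_perp_x a x hy,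
      sum_perp_mul_ell _ hy]
    simp only [phi4]
    ring
  have hmX : ∑ j, ∑ k, (fundamental (metric φ a) x y)⁻¹ j k
        * (ang y i j * perp x y k + ang y i k * perp x y j) = _ :=
    sum_sum_mul_symm_mul hG hX (ang y i)
  have hmA : ∑ j, ∑ k, (fundamental (metric φ a) x y)⁻¹ j k
        * (ang y i j * perp a y k + ang y i k * perp a y j) = _ :=
    sum_sum_mul_symm_mul hG hA (ang y i)
  rw [hcontr, sum_ang_mul_perp _ hy, sum_ang_mul_perp _ hy, sum_ang_mul_ell hy] at hmX hmA
  -- The covector F_y has length one for g⁻¹, because g⁻¹F_y = ℓ/φ and F_y(y) = F.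
  have hFF : ∑ j, ∑ k, (fundamental (metric φ a) x y)⁻¹ j k
      * (radialD1 φ a x y j * radialD1 φ a x y k) = 1 := by
    rw [sum_sum_mul_mul (h.sum_inv_fundamental_mul_radialD1 hx hy)]
    have hl : ∀ j, radialD1 φ a x y j * ((φ (invariants a x y))⁻¹ * ell y j)
        = (φ (invariants a x y))⁻¹ * ‖y‖⁻¹ * (radialD1 φ a x y j * y j) := fun j => by
      simp only [ell]
      ring
    have h0 : ‖y‖ ≠ 0 := norm_ne_zero_iff.2 hy
    rw [Finset.sum_congr rfl fun j _ => hl j, ← Finset.mul_sum, sum_radialD1_mul_y _ _ _ hy]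
    field_simp
  -- The trace of m is read off from g^{jk}g_{jk} = n, all other parts of g having known
  -- contractions. This is where the dimension enters K and H.
  have htr : ∑ j, ∑ k, (fundamental (metric φ a) x y)⁻¹ j k * ang y j k
      = (n - 1 - A φ (‖a‖ ^ 2) (invariants a x y) * us (invariants a x y)
        - 2 * B φ (‖a‖ ^ 2) (invariants a x y) * vst (invariants a x y)
        - C φ (‖a‖ ^ 2) (invariants a x y) * at2 (‖a‖ ^ 2) (invariants a x y))
        / c0 φ (invariants a x y) := by
    have hn := h.sum_sum_inv_fundamental_mul_fundamental hx hy
    -- The final summand with coefficient 0 pads the expansion to six terms.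
    have hg : ∀ j k, fundamental (metric φ a) x y j k
        = c0 φ (invariants a x y) * ang y j k
        + φ (invariants a x y) * ds (ds φ) (invariants a x y) * (perp x y j * perp x y k)
        + φ (invariants a x y) * dt (ds φ) (invariants a x y)
          * (perp x y j * perp a y k + perp x y k * perp a y j)
        + φ (invariants a x y) * dt (dt φ) (invariants a x y) * (perp a y j * perp a y k)
        + 1 * (radialD1 φ a x y j * radialD1 φ a x y k)
        + 0 * (radialD1 φ a x y j * radialD1 φ a x y k) := fun j k => by
      rw [fundamental_apply_eq h.isOpen h.smooth (h.mem x hx) hy]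
      ring
    simp only [hg] at hn
    rw [sum_sum_mul_linear_comb_six, hXX, hXA, hAA, hFF] at hn
    rw [eq_div_iff hc, mul_comm]
    have hABC : φ (invariants a x y) * ds (ds φ) (invariants a x y)
          * (-phi0 φ (‖a‖ ^ 2) (invariants a x y) / c0 φ (invariants a x y))
        + φ (invariants a x y) * dt (ds φ) (invariants a x y)
          * (-2 * phi3 φ (‖a‖ ^ 2) (invariants a x y) / c0 φ (invariants a x y))
        + φ (invariants a x y) * dt (dt φ) (invariants a x y)
          * (-phi4 φ (‖a‖ ^ 2) (invariants a x y) / c0 φ (invariants a x y))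
        = A φ (‖a‖ ^ 2) (invariants a x y) * us (invariants a x y)
        + 2 * B φ (‖a‖ ^ 2) (invariants a x y) * vst (invariants a x y)
        + C φ (‖a‖ ^ 2) (invariants a x y) * at2 (‖a‖ ^ 2) (invariants a x y) := by
      rw [hcσ]
      simp only [phi0, phi3, phi4, A, B, C]
      field_simp
      simp only [rho, hess]
      ring
    linear_combination hn - hABC
  have hL : ∀ j k, landsberg (metric φ a) i j k x y
      = -(φ (invariants a x y) / 2) * (L1 φ (‖a‖ ^ 2) (invariants a x y) * perp x y i
          + L5 φ (‖a‖ ^ 2) (invariants a x y) * perp a y i) * (perp x y j * perp x y k)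
        + -(φ (invariants a x y) / 2) * (L5 φ (‖a‖ ^ 2) (invariants a x y) * perp x y i
          + L6 φ (‖a‖ ^ 2) (invariants a x y) * perp a y i)
          * (perp x y j * perp a y k + perp x y k * perp a y j)
        + -(φ (invariants a x y) / 2) * (L6 φ (‖a‖ ^ 2) (invariants a x y) * perp x y i
          + L3 φ (‖a‖ ^ 2) (invariants a x y) * perp a y i) * (perp a y j * perp a y k)
        + -(φ (invariants a x y) / 2) * (L2 φ (‖a‖ ^ 2) (invariants a x y) * perp x y i
          + L4 φ (‖a‖ ^ 2) (invariants a x y) * perp a y i) * ang y j k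
        + -(φ (invariants a x y) / 2) * L2 φ (‖a‖ ^ 2) (invariants a x y)
          * (ang y i j * perp x y k + ang y i k * perp x y j)
        + -(φ (invariants a x y) / 2) * L4 φ (‖a‖ ^ 2) (invariants a x y)
          * (ang y i j * perp a y k + ang y i k * perp a y j) := fun j k => by
    rw [h.landsberg_eq hx hy]
    ring
  simp only [meanLandsberg, hL]
  rw [sum_sum_mul_linear_comb_six, hXX, hXA, hAA, htr, hmX, hmA]
  simp only [K, H, phi1, phi2, phi5, phi6]
  field_simp
  ring

end RegularOn

/-! ### The mean stretch curvature -/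

theorem radialD2_comm (f : (Fin 4 → ℝ) → ℝ) (a x y : E n) (j k : Fin n) :
    radialD2 f a x y j k = radialD2 f a x y k j := by
  simp only [radialD2, ang_comm y j k]
  ring

theorem radialSqD2_comm (f : (Fin 4 → ℝ) → ℝ) (a x y : E n) (j k : Fin n) :
    radialSqD2 f a x y j k = radialSqD2 f a x y k j := by
  simp only [radialSqD2, ang_comm y j k, delta_comm j k]
  ring

namespace RegularOn

variable {O : Set (Fin 4 → ℝ)} {φ : (Fin 4 → ℝ) → ℝ} {a x y : E n} {U : Set (E n)}

theorem contDiffOn_K (h : RegularOn φ a U O) : ContDiffOn ℝ ∞ (K n φ (‖a‖ ^ 2)) O :=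
  (contDiffOn_K_H n h.isOpen h.smooth h.phi_ne h.c0_ne h.rho_ne).1

theorem contDiffOn_H (h : RegularOn φ a U O) : ContDiffOn ℝ ∞ (H n φ (‖a‖ ^ 2)) O :=
  (contDiffOn_K_H n h.isOpen h.smooth h.phi_ne h.c0_ne h.rho_ne).2

/-- J is 0-homogeneous in y, so its derivative has no ℓ_m component; the zero term is kept only to
fit `sum_linear_comb_four_mul`. -/
theorem dy_meanLandsberg (h : RegularOn φ a U O) (hx : x ∈ U) (hy : y ≠ 0) (m i : Fin n) :
    dy m (meanLandsberg (metric φ a) i) x y =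
      ‖y‖⁻¹ * (ds (K n φ (‖a‖ ^ 2)) (invariants a x y) * perp x y i
          + ds (H n φ (‖a‖ ^ 2)) (invariants a x y) * perp a y i
          - K n φ (‖a‖ ^ 2) (invariants a x y) * ell y i) * perp x y m
        + ‖y‖⁻¹ * (dt (K n φ (‖a‖ ^ 2)) (invariants a x y) * perp x y i
          + dt (H n φ (‖a‖ ^ 2)) (invariants a x y) * perp a y i
          - H n φ (‖a‖ ^ 2) (invariants a x y) * ell y i) * perp a y m
        + -‖y‖⁻¹ * (invariants a x y 1 * K n φ (‖a‖ ^ 2) (invariants a x y)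
          + invariants a x y 3 * H n φ (‖a‖ ^ 2) (invariants a x y)) * ang y i m
        + 0 * ell y m := by
  have hc : ∀ {g}, ContDiffOn ℝ ∞ g O → _ := fun hg => hasDirDeriv_comp_invariants m a x hy
    (differentiableAt_of_contDiffOn h.isOpen hg (h.mem x hx y hy))
  refine dy_eq_of_hasDirDeriv hy (f₀ := fun x y =>
    K n φ (‖a‖ ^ 2) (invariants a x y) * perp x y i
      + H n φ (‖a‖ ^ 2) (invariants a x y) * perp a y i)
    (fun z hz => h.meanLandsberg_eq hx hz i)
    ((((hc h.contDiffOn_K).mul (hasDirDeriv_perp m i x hy)).add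
      ((hc h.contDiffOn_H).mul (hasDirDeriv_perp m i a hy))).congr_deriv ?_)
  rw [ang_comm]
  simp only [ang, invariants, Matrix.cons_val]
  ring

theorem dx_meanLandsberg (hU : IsOpen U) (h : RegularOn φ a U O) (hx : x ∈ U) (hy : y ≠ 0)
    (j i : Fin n) :
    dx j (meanLandsberg (metric φ a) i) x y =
      (2 * du (K n φ (‖a‖ ^ 2)) (invariants a x y) * x j
          + ds (K n φ (‖a‖ ^ 2)) (invariants a x y) * ell y j
          + dv (K n φ (‖a‖ ^ 2)) (invariants a x y) * a j) * perp x y i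
        + K n φ (‖a‖ ^ 2) (invariants a x y) * ang y j i
        + (2 * du (H n φ (‖a‖ ^ 2)) (invariants a x y) * x j
          + ds (H n φ (‖a‖ ^ 2)) (invariants a x y) * ell y j
          + dv (H n φ (‖a‖ ^ 2)) (invariants a x y) * a j) * perp a y i := by
  have hc : ∀ {g}, ContDiffOn ℝ ∞ g O → _ := fun hg => hasDirDeriv_comp_invariants_left j a x y
    (differentiableAt_of_contDiffOn h.isOpen hg (h.mem x hx y hy))
  refine dx_eq_of_hasDirDeriv hU hx (f₀ := fun x y =>
    K n φ (‖a‖ ^ 2) (invariants a x y) * perp x y i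
      + H n φ (‖a‖ ^ 2) (invariants a x y) * perp a y i)
    (fun z hz => h.meanLandsberg_eq hz hy i)
    ((((hc h.contDiffOn_K).mul (hasDirDeriv_perp_left j i x y)).add
      ((hc h.contDiffOn_H).mul (.const (perp a y i)))).congr_deriv ?_)
  simp only [ang]
  ring

/-- The part of ∂G^m/∂yʲ along y^m drops out by 0-homogeneity of J_i, and its δ-part returns rP
∂J_i/∂yʲ. Only the contractions of ∂J_i/∂y^m with x and a need work. -/
theorem sum_dy_meanLandsberg_mul_dy_spray (h : RegularOn φ a U O) (hx : x ∈ U) (hy : y ≠ 0)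
    (i j : Fin n) :
    ∑ m, dy m (meanLandsberg (metric φ a) i) x y * dy j (spray (metric φ a) m) x y
      = ‖y‖ * P φ (‖a‖ ^ 2) (invariants a x y) * dy j (meanLandsberg (metric φ a) i) x y
        + radialSqD1 (Q φ (‖a‖ ^ 2)) a x y j * ‖y‖⁻¹
          * ((ds (K n φ (‖a‖ ^ 2)) (invariants a x y) * perp x y i
              + ds (H n φ (‖a‖ ^ 2)) (invariants a x y) * perp a y i
              - K n φ (‖a‖ ^ 2) (invariants a x y) * ell y i) * us (invariants a x y)
            + (dt (K n φ (‖a‖ ^ 2)) (invariants a x y) * perp x y i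
              + dt (H n φ (‖a‖ ^ 2)) (invariants a x y) * perp a y i
              - H n φ (‖a‖ ^ 2) (invariants a x y) * ell y i) * vst (invariants a x y)
            - (invariants a x y 1 * K n φ (‖a‖ ^ 2) (invariants a x y)
              + invariants a x y 3 * H n φ (‖a‖ ^ 2) (invariants a x y)) * perp x y i)
        + radialSqD1 (R φ (‖a‖ ^ 2)) a x y j * ‖y‖⁻¹
          * ((ds (K n φ (‖a‖ ^ 2)) (invariants a x y) * perp x y i
              + ds (H n φ (‖a‖ ^ 2)) (invariants a x y) * perp a y i
              - K n φ (‖a‖ ^ 2) (invariants a x y) * ell y i) * vst (invariants a x y)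
            + (dt (K n φ (‖a‖ ^ 2)) (invariants a x y) * perp x y i
              + dt (H n φ (‖a‖ ^ 2)) (invariants a x y) * perp a y i
              - H n φ (‖a‖ ^ 2) (invariants a x y) * ell y i) * at2 (‖a‖ ^ 2) (invariants a x y)
            - (invariants a x y 1 * K n φ (‖a‖ ^ 2) (invariants a x y)
              + invariants a x y 3 * H n φ (‖a‖ ^ 2) (invariants a x y)) * perp a y i) := by
  have h0 : ‖y‖ ≠ 0 := norm_ne_zero_iff.2 hy
  have hJ := fun z : Fin n → ℝ => Finset.sum_congr rfl fun m (_ : m ∈ Finset.univ) =>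
    congrArg (· * z m) (h.dy_meanLandsberg hx hy m i)
  simp only [sum_linear_comb_four_mul] at hJ
  have hXy : ∑ m, perp x y m * y m = 0 := by
    rw [sum_perp_mul, real_inner_self_eq_norm_sq]
    field_simp
    ring
  have hAy : ∑ m, perp a y m * y m = 0 := by
    rw [sum_perp_mul, real_inner_self_eq_norm_sq]
    field_simp
    ring
  have hmy : perp y y i = 0 := by
    simp only [perp, ell, real_inner_self_eq_norm_sq]
    field_simp
    ring
  have hXx : ∑ m, perp x y m * x m = us (invariants a x y) := by
    rw [sum_perp_mul, real_inner_self_eq_norm_sq]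
    simp only [us, invariants, Matrix.cons_val]
    ring
  have hXa : ∑ m, perp x y m * a m = vst (invariants a x y) := by
    rw [sum_perp_mul, real_inner_comm]
    simp only [vst, invariants, Matrix.cons_val]
  have hAx : ∑ m, perp a y m * x m = vst (invariants a x y) := by
    rw [sum_perp_mul]
    simp only [vst, invariants, Matrix.cons_val]
    ring
  have hAa : ∑ m, perp a y m * a m = at2 (‖a‖ ^ 2) (invariants a x y) := by
    rw [sum_perp_mul, real_inner_self_eq_norm_sq]
    simp only [at2, invariants, Matrix.cons_val]
    ring
  have hsum : ∀ m, dy m (meanLandsberg (metric φ a) i) x y * dy j (spray (metric φ a) m) x y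
      = radialD1 (P φ (‖a‖ ^ 2)) a x y j * (dy m (meanLandsberg (metric φ a) i) x y * y m)
        + ‖y‖ * P φ (‖a‖ ^ 2) (invariants a x y)
          * (dy m (meanLandsberg (metric φ a) i) x y * delta j m)
        + radialSqD1 (Q φ (‖a‖ ^ 2)) a x y j * (dy m (meanLandsberg (metric φ a) i) x y * x m)
        + radialSqD1 (R φ (‖a‖ ^ 2)) a x y j
          * (dy m (meanLandsberg (metric φ a) i) x y * a m) := by
    intro m
    rw [h.dy_spray hx hy]
    ring
  simp only [hsum, Finset.sum_add_distrib, ← Finset.mul_sum, sum_mul_delta]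
  rw [hJ (fun m => y m), hJ (fun m => x m), hJ (fun m => a m)]
  simp only [sum_ang_mul_coord, hXy, hAy, hmy, hXx, hXa, hAx, hAa]
  ring

/-- In terms of ξ, η, ℓ the curvature is 2(T ξ∧η + Z η∧ℓ + W ξ∧ℓ). Since ξ∧η = x∧a - t x∧ℓ + s a∧ℓ,
passing to x, a, y produces the corrections sT and -tT. -/
theorem meanStretch_eq (hU : IsOpen U) (h : RegularOn φ a U O) (hx : x ∈ U) (hy : y ≠ 0)
    (i j : Fin n) :
    meanStretch (metric φ a) i j x y = 2 * ‖y‖⁻¹ *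
      (‖y‖ * T n φ (‖a‖ ^ 2) (invariants a x y) * (x i * a j - x j * a i)
          + (invariants a x y 1 * T n φ (‖a‖ ^ 2) (invariants a x y)
              + Z n φ (‖a‖ ^ 2) (invariants a x y)) * (a i * y j - a j * y i)
          + (W n φ (‖a‖ ^ 2) (invariants a x y)
              - invariants a x y 3 * T n φ (‖a‖ ^ 2) (invariants a x y))
            * (x i * y j - x j * y i)) := by
  have h0 : ‖y‖ ≠ 0 := norm_ne_zero_iff.2 hy
  -- Symmetry of ∂²G^m/∂yⁱ∂yʲ removes the terms with undifferentiated J_m from the skew part.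
  have hsymm : ∀ m, dy j (dy i (spray (metric φ a) m)) x y
      = dy i (dy j (spray (metric φ a) m)) x y := by
    intro m
    rw [h.dy_dy_spray hx hy, h.dy_dy_spray hx hy, radialD2_comm _ _ _ _ j i,
      radialSqD2_comm _ _ _ _ j i, radialSqD2_comm _ _ _ _ j i]
    ring
  have hX : ∀ l, x l = perp x y l + invariants a x y 1 * ell y l := fun l => by
    simp only [perp, invariants, Matrix.cons_val]
    ring
  have hA : ∀ l, a l = perp a y l + invariants a x y 3 * ell y l := fun l => by
    simp only [perp, invariants, Matrix.cons_val]
    ring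
  simp only [meanStretch, horizontalDeriv, hsymm]
  rw [h.sum_dy_meanLandsberg_mul_dy_spray hx hy, h.sum_dy_meanLandsberg_mul_dy_spray hx hy]
  simp only [h.dx_meanLandsberg hU hx hy, h.dy_meanLandsberg hx hy]
  rw [hX i, hX j, hA i, hA j, ← norm_mul_ell hy i, ← norm_mul_ell hy j, ang_comm y j i]
  simp only [radialSqD1, T, Z, W]
  generalize perp x y = X
  generalize perp a y = A
  field_simp
  ring

end RegularOn

/-! ### Dimension one -/

theorem perp_eq_zero_of_dim_one (z : E 1) {y : E 1} (hy : y ≠ 0) (i : Fin 1) :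
    perp z y i = 0 := by
  have h1 := sum_ell_mul_ell hy
  have h2 := sum_perp_mul_ell z hy
  simp only [Fin.sum_univ_one] at h1 h2
  rw [Subsingleton.elim i 0]
  have h3 : ell y 0 ≠ 0 := fun h => by simp [h] at h1
  exact (mul_eq_zero.1 h2).resolve_right h3

theorem invariants_smul (a x y : E n) {c : ℝ} (hc : 0 < c) :
    invariants a x (c • y) = invariants a x y := by
  simp only [invariants, inner_smul_right, norm_smul, Real.norm_eq_abs, abs_of_pos hc,
    mul_div_mul_left _ _ hc.ne']

section DimOne

variable {f : E 1 → ℝ} {y : E 1}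

theorem coord_ne_zero (hy : y ≠ 0) : y 0 ≠ 0 := fun h => hy (by
  ext i
  rw [Subsingleton.elim i 0, h]
  rfl)

/-- Euler's relation for positively 2-homogeneous functions on the line. -/
theorem hasDirDeriv_of_homogeneous (hf : ∀ y ≠ 0, ∀ c : ℝ, 0 < c → f (c • y) = c ^ 2 * f y)
    (hy : y ≠ 0) (i : Fin 1) :
    HasDirDeriv (EuclideanSpace.single i 1) f y (2 * (y 0)⁻¹ * f y) := by
  have h0 := coord_ne_zero hy
  have hc : Continuous fun z : E 1 => z 0 * (y 0)⁻¹ :=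
    ((EuclideanSpace.proj 0 : E 1 →L[ℝ] ℝ).continuous).mul continuous_const
  -- Near y only points on the same half-line occur, and there homogeneity makes f a multiple of the
  -- squared coordinate.
  have hev : f =ᶠ[nhds y] fun z => (z 0 * (y 0)⁻¹) * (z 0 * (y 0)⁻¹) * f y := by
    have hpos : ∀ᶠ z in nhds y, 0 < z 0 * (y 0)⁻¹ :=
      (isOpen_lt continuous_const hc).eventually_mem
        (show 0 < y 0 * (y 0)⁻¹ by rw [mul_inv_cancel₀ h0]; exact one_pos)
    filter_upwards [hpos] with z hz
    have hzy : z = (z 0 * (y 0)⁻¹) • y := by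
      ext j
      rw [Subsingleton.elim j 0]
      simp [h0]
    conv_lhs => rw [hzy]
    rw [hf y hy _ hz]
    ring
  have hd := (hasDirDeriv_coord i 0 y).mul (.const (y 0)⁻¹)
  refine (((hd.mul hd).mul (.const (f y))).congr_deriv ?_).congr_of_eventuallyEq hev
  rw [show delta i 0 = 1 by simp [delta, Subsingleton.elim i 0]]
  field_simp
  ring

/-- On each half-line f is quadratic. The successive derivatives are 2f/y, 2f/y² and 0. -/
theorem dy_dy_dy_eq_zero_of_homogeneous {f : E 1 → E 1 → ℝ} {x y : E 1}
    (hf : ∀ y ≠ 0, ∀ c : ℝ, 0 < c → f x (c • y) = c ^ 2 * f x y) (hy : y ≠ 0) (i j k : Fin 1) :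
    dy i (dy j (dy k f)) x y = 0 := by
  have hinv : ∀ {y : E 1}, y ≠ 0 → ∀ i : Fin 1, HasDirDeriv (EuclideanSpace.single i 1)
      (fun z : E 1 => (z 0)⁻¹) y (-(y 0)⁻¹ * (y 0)⁻¹) := fun {y} hy i => by
    refine ((hasDirDeriv_coord i 0 y).inv (coord_ne_zero hy)).congr_deriv ?_
    rw [show delta i 0 = 1 by simp [delta, Subsingleton.elim i 0]]
    ring
  have h1 : ∀ z ≠ 0, dy k f x z = 2 * (z 0)⁻¹ * f x z := fun z hz =>
    (hasDirDeriv_of_homogeneous hf hz k).fderiv_eq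
  have h2 : ∀ z ≠ 0, dy j (dy k f) x z = 2 * (z 0)⁻¹ * (z 0)⁻¹ * f x z := fun z hz =>
    dy_eq_of_hasDirDeriv (f₀ := fun x z => 2 * (z 0)⁻¹ * f x z) hz h1
      ((((HasDirDeriv.const 2).mul (hinv hz j)).mul
        (hasDirDeriv_of_homogeneous hf hz j)).congr_deriv (by ring))
  exact dy_eq_of_hasDirDeriv (f₀ := fun x z => 2 * (z 0)⁻¹ * (z 0)⁻¹ * f x z) hy h2
    (((((HasDirDeriv.const 2).mul (hinv hy i)).mul (hinv hy i)).mul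
      (hasDirDeriv_of_homogeneous hf hy i)).congr_deriv (by ring))

/-- The formula for the spray needs no ρ ≠ 0 here because ξ = η = 0, and it exhibits G as
2-homogeneous. -/
theorem meanLandsberg_eq_zero_of_dim_one {O : Set (Fin 4 → ℝ)} {φ : (Fin 4 → ℝ) → ℝ}
    {a x y : E 1} (hO : IsOpen O) (hφ : ContDiffOn ℝ ∞ φ O)
    (hp : ∀ z : E 1, z ≠ 0 → invariants a x z ∈ O)
    (hg : ∀ z : E 1, z ≠ 0 → (fundamental (metric φ a) x z).PosDef) (hy : y ≠ 0) (i : Fin 1) :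
    meanLandsberg (metric φ a) i x y = 0 := by
  have hG : ∀ l, ∀ y ≠ 0, ∀ c : ℝ, 0 < c →
      spray (metric φ a) l x (c • y) = c ^ 2 * spray (metric φ a) l x y := by
    intro l y hy c hc
    have hcy : c • y ≠ 0 := smul_ne_zero hc.ne' hy
    rw [spray_eq hO hφ hp hy (hg y hy) (.inr fun i =>
        ⟨perp_eq_zero_of_dim_one x hy i, perp_eq_zero_of_dim_one a hy i⟩),
      spray_eq hO hφ hp hcy (hg _ hcy) (.inr fun i =>
        ⟨perp_eq_zero_of_dim_one x hcy i, perp_eq_zero_of_dim_one a hcy i⟩),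
      invariants_smul a x y hc, norm_smul, Real.norm_eq_abs, abs_of_pos hc, PiLp.smul_apply,
      smul_eq_mul]
    ring
  simp only [meanLandsberg, landsberg, dy_dy_dy_eq_zero_of_homogeneous (hG _) hy, mul_zero,
    Finset.sum_const_zero]

end DimOne

/-! ### Dimension at least two -/

/-- P, Q, R, K, H get differentiated as functions of four variables, so the divisors must be nonzero
on an open set and not just at the attained values, which need not fill one. Removing the closed
zero set of φ c₀ ρ from Ω achieves this. -/
theorem exists_regularOn (hn : 2 ≤ n) {a : E n} {U : Set (E n)} {Ω : Set (Fin 4 → ℝ)}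
    (hΩ : IsOpen Ω) (hUΩ : ∀ x ∈ U, ∀ y : E n, y ≠ 0 → invariants a x y ∈ Ω)
    {φ : (Fin 4 → ℝ) → ℝ} (hφ : ContDiffOn ℝ ∞ φ Ω)
    (hg : ∀ x ∈ U, ∀ y : E n, y ≠ 0 → (fundamental (metric φ a) x y).PosDef)
    (hc0 : n = 2 → ∀ x ∈ U, ∀ y : E n, y ≠ 0 → c0 φ (invariants a x y) ≠ 0) :
    ∃ O, RegularOn φ a U O := by
  have hcont : ContinuousOn (fun p => φ p * c0 φ p * rho φ (‖a‖ ^ 2) p) Ω :=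
    (hφ.continuousOn.mul (contDiffOn_c0 hΩ hφ).continuousOn).mul
      (contDiffOn_rho (‖a‖ ^ 2) hΩ hφ).continuousOn
  refine ⟨Ω ∩ (fun p => φ p * c0 φ p * rho φ (‖a‖ ^ 2) p) ⁻¹' {0}ᶜ,
    hcont.isOpen_inter_preimage hΩ isOpen_compl_singleton, hφ.mono Set.inter_subset_left,
    fun p hp => ?_, fun p hp => ?_, fun p hp => ?_, fun x hx y hy => ⟨hUΩ x hx y hy, ?_⟩, hg⟩
  · exact left_ne_zero_of_mul (left_ne_zero_of_mul hp.2)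
  · exact right_ne_zero_of_mul (left_ne_zero_of_mul hp.2)
  · exact right_ne_zero_of_mul hp.2
  · have hc : c0 φ (invariants a x y) ≠ 0 := by
      rcases hn.eq_or_lt with h2 | h3
      · exact hc0 h2.symm x hx y hy
      · exact c0_ne_zero_of_three_le h3 hΩ hφ (hUΩ x hx) (hg x hx) hy
    exact mul_ne_zero (mul_ne_zero (phi_ne_zero hΩ hφ (hUΩ x hx) hy (hg x hx y hy)) hc)
      (rho_ne_zero hΩ hφ (hUΩ x hx) hy (hg x hx y hy) hc)

end GSS

end

/-! ### The main theorem -/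

open GSS in
/-- `φ` is a smooth function of `(u, s, v, t)` on an open set `Ω` that contains all the values of
the invariants over the slit tangent bundle of `U`. In dimension 2 the coefficient `c₀`, by which
`H` and `K` are divided, is required not to vanish; in every dimension `n ≥ 3` this is automatic,
and it is not needed for `n ≤ 1`. -/
theorem theorem2 (n : ℕ) (a : E n) (U : Set (E n)) (hU : IsOpen U)
    (Ω : Set (Fin 4 → ℝ)) (hΩ : IsOpen Ω)
    (hUΩ : ∀ x ∈ U, ∀ y : E n, y ≠ 0 → invariants a x y ∈ Ω)
    (φ : (Fin 4 → ℝ) → ℝ) (hφ : ContDiffOn ℝ ∞ φ Ω)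
    (hF : IsFinslerMetricOn U (metric φ a))
    (hc0 : n = 2 → ∀ x ∈ U, ∀ y : E n, y ≠ 0 → c0 φ (invariants a x y) ≠ 0) :
    (∀ x ∈ U, ∀ y : E n, y ≠ 0 → ∀ i,
      spray (metric φ a) i x y =
        ‖y‖ * P φ (‖a‖ ^ 2) (invariants a x y) * y i
          + ‖y‖ ^ 2 * Q φ (‖a‖ ^ 2) (invariants a x y) * x i
          + ‖y‖ ^ 2 * R φ (‖a‖ ^ 2) (invariants a x y) * a i) ∧
    (∀ x ∈ U, ∀ y : E n, y ≠ 0 → ∀ i,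
      meanLandsberg (metric φ a) i x y =
        K n φ (‖a‖ ^ 2) (invariants a x y) * (x i - invariants a x y 1 * (y i / ‖y‖))
          + H n φ (‖a‖ ^ 2) (invariants a x y) * (a i - invariants a x y 3 * (y i / ‖y‖))) ∧
    (IsWeaklyStretchOn U (metric φ a) ↔
      ∀ x ∈ U, ∀ y : E n, y ≠ 0 → ∀ i j,
        ‖y‖ * T n φ (‖a‖ ^ 2) (invariants a x y) * (x i * a j - x j * a i)
          + (invariants a x y 1 * T n φ (‖a‖ ^ 2) (invariants a x y)
              + Z n φ (‖a‖ ^ 2) (invariants a x y)) * (a i * y j - a j * y i)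
          + (W n φ (‖a‖ ^ 2) (invariants a x y)
              - invariants a x y 3 * T n φ (‖a‖ ^ 2) (invariants a x y))
            * (x i * y j - x j * y i) = 0) := by
  have hspray : (∀ x ∈ U, ∀ y : E n, y ≠ 0 → rho φ (‖a‖ ^ 2) (invariants a x y) ≠ 0 ∨
      ∀ i, perp x y i = 0 ∧ perp a y i = 0) → ∀ x ∈ U, ∀ y : E n, y ≠ 0 → ∀ i,
      spray (metric φ a) i x y =
        ‖y‖ * P φ (‖a‖ ^ 2) (invariants a x y) * y i
          + ‖y‖ ^ 2 * Q φ (‖a‖ ^ 2) (invariants a x y) * x i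
          + ‖y‖ ^ 2 * R φ (‖a‖ ^ 2) (invariants a x y) * a i := by
    intro h x hx y hy i
    rw [spray_eq hΩ hφ (hUΩ x hx) hy (hF.posDef x hx y hy) (h x hx y hy)]
    ring
  have hperp : ∀ x y : E n, ∀ i, x i - invariants a x y 1 * (y i / ‖y‖) = perp x y i ∧
      a i - invariants a x y 3 * (y i / ‖y‖) = perp a y i := fun _ _ _ => ⟨rfl, rfl⟩
  simp only [hperp]
  rcases Nat.lt_or_ge n 2 with hn | hn
  -- For n = 0 there are no indices. For n = 1 the formula for J reads 0 = 0 whatever K and H are,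
  -- and both stretch conditions are skew in i, j, hence empty.
  · interval_cases n
    · exact ⟨fun _ _ _ _ i => i.elim0, fun _ _ _ _ i => i.elim0,
        fun _ _ _ _ _ i => i.elim0, fun _ _ _ _ _ i => i.elim0⟩
    · refine ⟨hspray fun x _ y hy => .inr fun i =>
        ⟨perp_eq_zero_of_dim_one x hy i, perp_eq_zero_of_dim_one a hy i⟩, fun x hx y hy i => ?_,
        fun _ x _ y _ i j => ?_, fun _ x _ y _ i j => ?_⟩
      · rw [meanLandsberg_eq_zero_of_dim_one hΩ hφ (hUΩ x hx) (hF.posDef x hx) hy,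
          perp_eq_zero_of_dim_one x hy, perp_eq_zero_of_dim_one a hy]
        ring
      · rw [Subsingleton.elim i j]
        ring
      · rw [Subsingleton.elim i j, meanStretch]
        ring
  · obtain ⟨O, h⟩ := exists_regularOn hn hΩ hUΩ hφ hF.posDef hc0
    refine ⟨hspray fun x hx y hy => .inl (h.rho_ne _ (h.mem x hx y hy)),
      fun x hx y hy i => h.meanLandsberg_eq hx hy i, ?_⟩
    -- The curvature is the displayed expression times 2/r, so the two conditions agree at each
    -- point and for each pair of indices.
    refine forall₂_congr fun x hx => forall₂_congr fun y hy => forall₂_congr fun i j => ?_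
    rw [h.meanStretch_eq hU hx hy]
    have h0 : ‖y‖ ≠ 0 := norm_ne_zero_iff.2 hy
    simp only [mul_eq_zero, inv_eq_zero, h0, OfNat.ofNat_ne_zero, false_or]
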